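/- Logarithms and $\exp$ are to base $2$, $\exp(x)=2^x$. Let $\mathcal H=\mathbb C^d$, let $\rho>0$ be a density operator on $\mathcal H$ with full support, and let $\mathbf a=(a_j)_{j=1,\dots,m}$ be a POVM on $\mathcal H$, that is, $a_j\ge 0$ and $\sum_j a_j=\mathbb 1$. Put $\lambda_j=\operatorname{Tr}(\rho a_j)$, $\hat\rho_j=\lambda_j^{-1}\sqrt\rho\,a_j\sqrt\rho$ (terms with $\lambda_j=0$ do not contribute below), and let $H(\sigma)=-\operatorname{Tr}\sigma\log\sigma$ be the von Neumann entropy. Let $(\nu_l)_{l\ge 0}$ be nonnegative integers with $\nu_l=o(l)$ as $l\to\infty$, and let $\epsilon>0$. Then there is a function $f(l)=o(l)$ such that for every $l$ there exist a number $M$ with $$M\le \exp\Big(l\Big(H(\rho)-\sum_j\lambda_jH(\hat\rho_j)\Big)+f(l)\Big),$$ a POVM $(A_\mu)_{\mu=1,\dots,M}$ on $\mathcal H^{\otimes l}$, and labels $j_\mu=(j_{\mu 1},\dots,j_{\mu l})\in\{1,\dots,m\}^l$ for $\mu=1,\dots,M$, such that $$\sum_{K\subset\{1,\dots,l\},\ |K|\le\nu_l}\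 \ \sum_{j^K\in\{1,\dots,m\}^K}\big\|A^{(K)}_{j^K}-a_{j^K}\big\|\le\epsilon .$$ Here $\|\cdot\|$ is the operator norm, $a_{j^K}=\bigotimes_{k\in K}a_{j_k}$, and $$A^{(K)}_{j^K}=\operatorname{Tr}_{[l]\setminus K}\Big(\big(\rho^{\otimes[l]\setminus K}\otimes\mathbb 1^{\otimes K}\big)\sum_{\mu:\ \forall k\in K\ j_{\mu k}=j_k}A_\mu\Big)$$ is the restriction of the labelled POVM to the tensor factors in $K$, where $[l]=\{1,\dots,l\}$. -/

import Mathlib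

open scoped ComplexOrder Matrix.Norms.L2Operator

noncomputable section

namespace QMeas

/-- `a` is a POVM: positive semidefinite operators that sum to the identity. -/
def IsPOVM {ι n : Type*} [Fintype ι] [Fintype n] [DecidableEq n]
    (a : ι → Matrix n n ℂ) : Prop :=
  (∀ i, (a i).PosSemidef) ∧ ∑ i, a i = 1

/-- Von Neumann entropy to base `2`, `-Tr(A log₂ A)` (with `0 log 0 = 0`), for Hermitian `A`. -/
def entropy {n : Type*} [Fintype n] [DecidableEq n] (A : Matrix n n ℂ) : ℝ :=
  (Matrix.trace (cfc Real.negMulLog A)).re / Real.log 2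

/-- The probability `λ = Tr(ρ a)` of an outcome with operator `a` in the state `ρ`. -/
def prob {d : ℕ} (ρ a : Matrix (Fin d) (Fin d) ℂ) : ℝ :=
  (Matrix.trace (ρ * a)).re

/-- The state `√ρ a √ρ / Tr(ρ a)` of the canonical ensemble; it is `0` when `Tr(ρ a) = 0`. -/
def canonicalState {d : ℕ} (ρ a : Matrix (Fin d) (Fin d) ℂ) : Matrix (Fin d) (Fin d) ℂ :=
  (((prob ρ a)⁻¹ : ℝ) : ℂ) • (cfc Real.sqrt ρ * a * cfc Real.sqrt ρ)

/-- The entropy defect `H(ρ) - ∑ⱼ λⱼ H(ρ̂ⱼ)`. -/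
def entropyDefect {d m : ℕ} (ρ : Matrix (Fin d) (Fin d) ℂ)
    (a : Fin m → Matrix (Fin d) (Fin d) ℂ) : ℝ :=
  entropy ρ - ∑ j, prob ρ (a j) * entropy (canonicalState ρ (a j))

/-- The tensor product `⨂ₖ B k` as an operator on `⨂ₖ ℂᵈ`, in the product basis, which is indexed
by the functions `κ → Fin d`. -/
def tensorProd {κ : Type*} [Fintype κ] {d : ℕ} (B : κ → Matrix (Fin d) (Fin d) ℂ) :
    Matrix (κ → Fin d) (κ → Fin d) ℂ :=
  Matrix.of fun x y => ∏ k, B k (x k) (y k)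

/-- The product basis vector of `(ℂᵈ)^{⊗l}` with labels `x` on the factors in `K` and `z` on the
others. -/
def glue {l d : ℕ} (K : Finset (Fin l)) (x : K → Fin d) (z : {k : Fin l // k ∉ K} → Fin d) :
    Fin l → Fin d :=
  fun k => if h : k ∈ K then x ⟨k, h⟩ else z ⟨k, h⟩

/-- The partial trace over the tensor factors outside `K`. -/
def partialTrace {l d : ℕ} (K : Finset (Fin l))
    (X : Matrix (Fin l → Fin d) (Fin l → Fin d) ℂ) : Matrix (K → Fin d) (K → Fin d) ℂ :=
  Matrix.of fun x y => ∑ z : {k : Fin l // k ∉ K} → Fin d, X (glue K x z) (glue K y z)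

/-- The element `A^{(K)}_{j^K}` of the restriction to the factors in `K` of a family of operators
`A μ` on `(ℂᵈ)^{⊗l}` whose outcome `μ` is labelled by the tuple `J μ`:
`Tr_{[l]∖K} ((ρ^{⊗[l]∖K} ⊗ 1^{⊗K}) ∑_{μ : ∀ k ∈ K, J μ k = j k} A μ)`. -/
def restriction {ι : Type*} [Fintype ι] {l d m : ℕ} (ρ : Matrix (Fin d) (Fin d) ℂ)
    (J : ι → Fin l → Fin m) (A : ι → Matrix (Fin l → Fin d) (Fin l → Fin d) ℂ)
    (K : Finset (Fin l)) (j : K → Fin m) : Matrix (K → Fin d) (K → Fin d) ℂ :=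
  partialTrace K
    (tensorProd (fun k => if k ∈ K then 1 else ρ) *
      ∑ μ with ∀ k : K, J μ k = j k, A μ)

/-- The total deviation of the restrictions of the labelled family `A` to all sets `K` of at most
`ν` factors from the product POVMs `a^{⊗K}`, in operator norm. -/
def restrictionError {ι : Type*} [Fintype ι] {l d m : ℕ} (ρ : Matrix (Fin d) (Fin d) ℂ)
    (a : Fin m → Matrix (Fin d) (Fin d) ℂ) (ν : ℕ)
    (J : ι → Fin l → Fin m) (A : ι → Matrix (Fin l → Fin d) (Fin l → Fin d) ℂ) : ℝ :=
  ∑ K : Finset (Fin l) with K.card ≤ ν, ∑ j : K → Fin m,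
    ‖restriction ρ J A K j - tensorProd (fun k : K => a (j k))‖

end QMeas

end

/-! Let `r` be the square root of `ρ^{⊗l}` and `S_J = a_{J 1} ⊗ ⋯ ⊗ a_{J l}`. The operators `r S_J r
= λ_J ρ̂_J` form an ensemble of product states with average `ρ^{⊗l}`. Suppose that positive
operators `B μ` with invertible sum `σ`, labelled by tuples, reproduce in trace norm the partial
sums of `r S_J r` over every event "the labels on `K` are `j`", `|K| ≤ ν`. The event with `K = ∅`
gives `σ ≈ r²`, so by Powers–Størmer `√σ ≈ r` in Hilbert–Schmidt norm, and the POVM `σ^{-1/2} B μ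
σ^{-1/2}` has nearly the right partial sums when weighted by `r` (`exists_povm_of_covering`). It
remains to cover the ensemble by few states.

Up to exponentially small weight (a Chernoff bound), the eigenvalues of `ρ̂_J` are at most `t ≈
exp(-l ∑ λⱼ H(ρ̂ⱼ))` and those of `ρ^{⊗l}` at least `s ≈ exp(-l H(ρ))`. Truncated accordingly, the
states have squared Hilbert–Schmidt norm at most `t` and live in dimension at most `1/s`. Among `N`
samples a second moment argument finds a choice whose squared Hilbert–Schmidt error is at most `|I|
t / N` for each of the `|I|` events; Cauchy–Schwarz on the small subspace makes this a trace norm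
error `√(|I| t / (s N))` (`exists_covering`). Hence any exponential rate of `N` above that of `t/s`,
which is the entropy defect, suffices.

The resulting error is exponentially small. The number of pairs `(K, j)` and the factor `q₀^{-ν}`
for removing the weight `ρ` on `K` (`norm_partialTrace_le`, with `q₀` a lower bound for the
eigenvalues of `ρ`) are subexponential because `ν = o(l)`, so the total deviation tends to `0`. -/

namespace QMeas

open Matrix

/-! ### Hilbert–Schmidt and trace norm estimates. -/

section MatrixAnalysis

variable {n : Type*} [Fintype n]

/-- The squared Hilbert–Schmidt norm. -/
noncomputable def hsSq (X : Matrix n n ℂ) : ℝ := ∑ i, ∑ j, ‖X i j‖ ^ 2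

lemma hsSq_nonneg (X : Matrix n n ℂ) : 0 ≤ hsSq X :=
  Finset.sum_nonneg fun _ _ => Finset.sum_nonneg fun _ _ => by positivity

lemma trace_conjTranspose_mul_self (X : Matrix n n ℂ) : (Xᴴ * X).trace = (hsSq X : ℂ) := by
  simp only [hsSq, trace, diag, mul_apply, conjTranspose_apply, Complex.ofReal_sum]
  rw [Finset.sum_comm]
  refine Finset.sum_congr rfl fun i _ => Finset.sum_congr rfl fun j _ => ?_
  rw [Complex.star_def, Complex.conj_mul']
  push_cast; rfl

lemma hsSq_conjTranspose (X : Matrix n n ℂ) : hsSq Xᴴ = hsSq X := by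
  simp only [hsSq, conjTranspose_apply, norm_star]
  exact Finset.sum_comm

lemma norm_trace_mul_le (X Y : Matrix n n ℂ) :
    ‖(X * Y).trace‖ ≤ √(hsSq X) * √(hsSq Y) := by
  have h1 : ‖(X * Y).trace‖ ≤ ∑ p : n × n, ‖X p.1 p.2‖ * ‖Y p.2 p.1‖ := by
    simp only [trace, diag, mul_apply]
    rw [Fintype.sum_prod_type]
    refine (norm_sum_le _ _).trans (Finset.sum_le_sum fun i _ => ?_)
    refine (norm_sum_le _ _).trans (Finset.sum_le_sum fun j _ => ?_)
    exact (norm_mul _ _).le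
  refine h1.trans ((Real.sum_mul_le_sqrt_mul_sqrt _ _ _).trans (le_of_eq ?_))
  congr 2
  · rw [Fintype.sum_prod_type, hsSq]
  · rw [Fintype.sum_prod_type, Finset.sum_comm, hsSq]

variable [DecidableEq n]

/-- The squared Hilbert–Schmidt norm is the sum of the squared lengths of the columns, and `W` acts
on each column separately. -/
lemma hsSq_mul_le (W X : Matrix n n ℂ) : hsSq (W * X) ≤ ‖W‖ ^ 2 * hsSq X := by
  rw [hsSq, hsSq, Finset.sum_comm, Finset.sum_comm (f := fun i j => ‖X i j‖ ^ 2), Finset.mul_sum]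
  refine Finset.sum_le_sum fun j _ => ?_
  have h := l2_opNorm_mulVec W (WithLp.toLp 2 (fun i => X i j))
  have h2 := pow_le_pow_left₀ (norm_nonneg _) h 2
  rw [mul_pow, EuclideanSpace.norm_sq_eq, EuclideanSpace.norm_sq_eq] at h2
  simpa [mulVec, dotProduct, mul_apply] using h2

lemma hsSq_mul_le' (X W : Matrix n n ℂ) : hsSq (X * W) ≤ hsSq X * ‖W‖ ^ 2 := by
  have := hsSq_mul_le Wᴴ Xᴴ
  rwa [← conjTranspose_mul, hsSq_conjTranspose, hsSq_conjTranspose, l2_opNorm_conjTranspose,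
    mul_comm] at this

lemma hsSq_mul_contraction {W : Matrix n n ℂ} (hW : ‖W‖ ≤ 1) (X : Matrix n n ℂ) :
    hsSq (X * W) ≤ hsSq X :=
  (hsSq_mul_le' X W).trans (mul_le_of_le_one_right (hsSq_nonneg X) (pow_le_one₀ (norm_nonneg _) hW))

lemma hsSq_contraction_mul {W : Matrix n n ℂ} (hW : ‖W‖ ≤ 1) (X : Matrix n n ℂ) :
    hsSq (W * X) ≤ hsSq X :=
  (hsSq_mul_le W X).trans (mul_le_of_le_one_left (hsSq_nonneg X) (pow_le_one₀ (norm_nonneg _) hW))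

lemma exists_conjTranspose_mul_self {P : Matrix n n ℂ} (hP : P.PosSemidef) :
    ∃ C : Matrix n n ℂ, P = Cᴴ * C ∧ hsSq C = P.trace.re := by
  open scoped MatrixOrder in
  obtain ⟨C, hC⟩ := CStarAlgebra.nonneg_iff_eq_star_mul_self.mp (nonneg_iff_posSemidef.mpr hP)
  refine ⟨C, hC, ?_⟩
  rw [hC, star_eq_conjTranspose, trace_conjTranspose_mul_self, Complex.ofReal_re]

lemma trace_mul_re_nonneg {P Q : Matrix n n ℂ} (hP : P.PosSemidef) (hQ : Q.PosSemidef) :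
    0 ≤ (P * Q).trace.re := by
  obtain ⟨C, rfl, -⟩ := exists_conjTranspose_mul_self hP
  rw [Matrix.mul_assoc, trace_mul_comm]
  exact (Complex.le_def.mp (hQ.mul_mul_conjTranspose_same C).trace_nonneg).1

/-- `X` has trace norm at most `c`, expressed by duality with the operator norm. -/
def TraceNormLE (X : Matrix n n ℂ) (c : ℝ) : Prop :=
  ∀ W : Matrix n n ℂ, ‖W‖ ≤ 1 → ‖(X * W).trace‖ ≤ c

lemma norm_one_le : ‖(1 : Matrix n n ℂ)‖ ≤ 1 := by
  rw [← diagonal_one, l2_opNorm_diagonal]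
  exact (pi_norm_le_iff_of_nonneg zero_le_one).mpr fun i => by simp

namespace TraceNormLE

variable {X Y : Matrix n n ℂ} {b c : ℝ}

lemma add (hX : TraceNormLE X b) (hY : TraceNormLE Y c) : TraceNormLE (X + Y) (b + c) := by
  intro W hW
  rw [Matrix.add_mul, trace_add]
  exact (norm_add_le _ _).trans (add_le_add (hX W hW) (hY W hW))

lemma neg (hX : TraceNormLE X b) : TraceNormLE (-X) b := by
  intro W hW
  rw [Matrix.neg_mul, trace_neg, norm_neg]
  exact hX W hW

lemma mono (hX : TraceNormLE X b) (h : b ≤ c) : TraceNormLE X c := fun W hW => (hX W hW).trans h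

lemma norm_trace_le (hX : TraceNormLE X b) : ‖X.trace‖ ≤ b := by
  simpa using hX 1 norm_one_le

lemma nonneg (hX : TraceNormLE X b) : 0 ≤ b := (norm_nonneg _).trans hX.norm_trace_le

/-- Cauchy–Schwarz for the trace pairing; a test contraction can be absorbed into `Y`. All trace
norm bounds below start from such a factorization. -/
lemma of_mul (X Y : Matrix n n ℂ) : TraceNormLE (X * Y) (√(hsSq X) * √(hsSq Y)) := by
  intro W hW
  rw [Matrix.mul_assoc]
  refine (norm_trace_mul_le _ _).trans ?_
  gcongr
  exact hsSq_mul_contraction hW Y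

lemma of_posSemidef {P : Matrix n n ℂ} (hP : P.PosSemidef) : TraceNormLE P P.trace.re := by
  obtain ⟨C, hC, hC2⟩ := exists_conjTranspose_mul_self hP
  have := of_mul Cᴴ C
  rwa [hsSq_conjTranspose, ← hC, Real.mul_self_sqrt (hsSq_nonneg _), hC2] at this

/-- A matrix whose left support is contained in a projection `Q` has trace norm at most
`√(Tr Q)` times its Hilbert–Schmidt norm. -/
lemma of_proj_mul {Q : Matrix n n ℂ} (hQ : Q.IsHermitian) (hQQ : Q * Q = Q) (hX : Q * X = X) :
    TraceNormLE X (√(Q.trace.re) * √(hsSq X)) := by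
  have h := of_mul Q X
  rw [hX] at h
  have h2 := trace_conjTranspose_mul_self Q
  rw [hQ.eq, hQQ] at h2
  rwa [h2, Complex.ofReal_re]

/-- Gentle compression: cutting a positive matrix `G` by a projection `Q` that carries almost all
of its trace changes it only slightly in trace norm. -/
lemma sub_compress {G Q : Matrix n n ℂ} (hG : G.PosSemidef) (hQ : Q.IsHermitian)
    (hQ1 : ‖Q‖ ≤ 1) (hQQ : Q * Q = Q) :
    TraceNormLE (G - Q * G * Q) (2 * (√((G * (1 - Q)).trace.re) * √(G.trace.re))) := by
  obtain ⟨C, hC, hC2⟩ := exists_conjTranspose_mul_self hG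
  have hcut : hsSq (C * (1 - Q)) = (G * (1 - Q)).trace.re := by
    have h := trace_conjTranspose_mul_self (C * (1 - Q))
    have hH : (1 - Q)ᴴ = 1 - Q := by rw [conjTranspose_sub, conjTranspose_one, hQ.eq]
    have hid : (1 - Q) * (1 - Q) = 1 - Q := by
      rw [Matrix.sub_mul, Matrix.mul_sub, Matrix.mul_sub, hQQ]; simp
    rw [conjTranspose_mul, hH, Matrix.mul_assoc, ← Matrix.mul_assoc Cᴴ, ← hC, trace_mul_comm,
      Matrix.mul_assoc, hid] at h
    rw [h, Complex.ofReal_re]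
  -- With `G = Cᴴ C`, both terms contain the factor `C (1 - Q)`, whose squared Hilbert–Schmidt norm
  -- is the trace lost by the cut.
  have e : G - Q * G * Q = (C * (1 - Q))ᴴ * C + (C * Q)ᴴ * (C * (1 - Q)) := by
    rw [hC]
    simp only [conjTranspose_mul, conjTranspose_sub, hQ.eq, Matrix.sub_mul,
      Matrix.mul_sub, Matrix.mul_assoc, Matrix.mul_one]
    abel
  rw [e, two_mul]
  refine add ?_ ?_
  · refine (of_mul _ _).mono ?_
    rw [hsSq_conjTranspose, hcut, hC2]
  · refine (of_mul _ _).mono ?_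
    rw [hsSq_conjTranspose, hcut, mul_comm, ← hC2]
    gcongr
    exact hsSq_mul_contraction hQ1 C

end TraceNormLE

/-- The matrix `U diag(f) U*`. -/
noncomputable def conjDiag (U : Matrix n n ℂ) (f : n → ℝ) : Matrix n n ℂ :=
  U * diagonal (fun i => (f i : ℂ)) * Uᴴ

section ConjDiag

variable {U : Matrix n n ℂ}

lemma conjDiag_isHermitian (U : Matrix n n ℂ) (f : n → ℝ) : (conjDiag U f).IsHermitian := by
  have : (diagonal fun i => (f i : ℂ))ᴴ = diagonal fun i => (f i : ℂ) := by
    rw [diagonal_conjTranspose]; congr 1; ext i; simp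
  rw [IsHermitian, conjDiag, conjTranspose_mul, conjTranspose_mul, conjTranspose_conjTranspose,
    this, Matrix.mul_assoc]

lemma conjDiag_posSemidef (U : Matrix n n ℂ) {f : n → ℝ} (hf : ∀ i, 0 ≤ f i) :
    (conjDiag U f).PosSemidef :=
  (PosSemidef.diagonal fun i => by simpa using hf i).mul_mul_conjTranspose_same U

lemma conjDiag_sub (U : Matrix n n ℂ) (f g : n → ℝ) :
    conjDiag U f - conjDiag U g = conjDiag U (f - g) := by
  rw [conjDiag, conjDiag, conjDiag, ← Matrix.sub_mul, ← Matrix.mul_sub, diagonal_sub]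
  simp

lemma conjDiag_smul (U : Matrix n n ℂ) (c : ℝ) (f : n → ℝ) :
    conjDiag U (c • f) = (c : ℂ) • conjDiag U f := by
  rw [conjDiag, conjDiag, ← Matrix.smul_mul, ← Matrix.mul_smul, ← diagonal_smul]
  congr 3
  ext i; simp

lemma conjDiag_mul (hU : Uᴴ * U = 1) (f g : n → ℝ) :
    conjDiag U f * conjDiag U g = conjDiag U (f * g) := by
  have : conjDiag U f * conjDiag U g =
      U * diagonal (fun i => (f i : ℂ)) * (Uᴴ * U) * diagonal (fun i => (g i : ℂ)) * Uᴴ := by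
    simp only [conjDiag, Matrix.mul_assoc]
  rw [this, hU, Matrix.mul_one, Matrix.mul_assoc U, diagonal_mul_diagonal, conjDiag]
  simp

lemma trace_conjDiag (hU : Uᴴ * U = 1) (f : n → ℝ) :
    (conjDiag U f).trace = ((∑ i, f i : ℝ) : ℂ) := by
  rw [conjDiag, trace_mul_comm, ← Matrix.mul_assoc, hU, Matrix.one_mul, trace_diagonal]
  push_cast; rfl

lemma conjDiag_one (hU : Uᴴ * U = 1) : conjDiag U 1 = 1 := by
  have h : U * Uᴴ = 1 := mul_eq_one_comm.mp hU
  simp [conjDiag, h]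

lemma norm_conjDiag_le (hU : Uᴴ * U = 1) {f : n → ℝ} {c : ℝ} (hc : 0 ≤ c) (hf : ∀ i, |f i| ≤ c) :
    ‖conjDiag U f‖ ≤ c := by
  have h1 : ‖U‖ ≤ 1 := by
    have := l2_opNorm_conjTranspose_mul_self U
    rw [hU] at this
    nlinarith [norm_one_le (n := n), norm_nonneg U]
  have h2 : ‖diagonal fun i => (f i : ℂ)‖ ≤ c := by
    rw [l2_opNorm_diagonal]
    exact (pi_norm_le_iff_of_nonneg hc).mpr fun i => by simpa using hf i
  calc ‖conjDiag U f‖ ≤ ‖U‖ * ‖diagonal fun i => (f i : ℂ)‖ * ‖Uᴴ‖ :=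
        (l2_opNorm_mul _ _).trans (by gcongr; exact l2_opNorm_mul _ _)
    _ ≤ 1 * c * 1 := by
        rw [l2_opNorm_conjTranspose]
        gcongr
    _ = c := by ring

end ConjDiag

/-- Spectral theorem, together with the functional calculus. -/
lemma exists_conjDiag {A : Matrix n n ℂ} (hA : A.IsHermitian) :
    ∃ (U : Matrix n n ℂ) (p : n → ℝ), Uᴴ * U = 1 ∧ A = conjDiag U p ∧
      (∀ f : ℝ → ℝ, cfc f A = conjDiag U (fun i => f (p i))) ∧ p = hA.eigenvalues := by
  refine ⟨hA.eigenvectorUnitary, hA.eigenvalues, ?_, ?_, fun f => ?_, rfl⟩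
  · exact Unitary.coe_star_mul_self hA.eigenvectorUnitary
  · conv_lhs => rw [hA.spectral_theorem, Unitary.conjStarAlgAut_apply]
    rfl
  · rw [hA.cfc_eq, IsHermitian.cfc, Unitary.conjStarAlgAut_apply]
    rfl

lemma exists_posSemidef_sqrt {A : Matrix n n ℂ} (hA : A.PosSemidef) :
    ∃ h : Matrix n n ℂ, h.PosSemidef ∧ h * h = A := by
  obtain ⟨U, p, hU, hA', -, hp⟩ := exists_conjDiag hA.1
  have hp0 : ∀ i, 0 ≤ p i := fun i => hp ▸ hA.eigenvalues_nonneg i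
  refine ⟨conjDiag U (fun i => √(p i)), conjDiag_posSemidef U fun i => Real.sqrt_nonneg _, ?_⟩
  rw [conjDiag_mul hU, hA']
  congr 1
  ext i
  exact Real.mul_self_sqrt (hp0 i)

/-- The Powers–Størmer inequality. -/
lemma hsSq_sub_le_of_traceNormLE {X Y : Matrix n n ℂ} (hX : X.PosSemidef) (hY : Y.PosSemidef)
    {c : ℝ} (h : TraceNormLE (X * X - Y * Y) c) : hsSq (X - Y) ≤ c := by
  have hT : (X - Y).IsHermitian := hX.1.sub hY.1
  obtain ⟨U, t, hU, hTU, -, -⟩ := exists_conjDiag hT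
  -- `W` is the sign of `X - Y`, so that `W (X - Y) = |X - Y|`; it is the contraction on which the
  -- hypothesis is tested.
  set s : n → ℝ := fun i => if 0 ≤ t i then 1 else -1 with hs
  set W := conjDiag U s with hW
  have hW1 : ‖W‖ ≤ 1 := norm_conjDiag_le hU zero_le_one fun i => by
    simp only [hs]; split_ifs <;> simp
  have hTW : (X - Y) * W = W * (X - Y) := by
    rw [hTU, conjDiag_mul hU, conjDiag_mul hU, mul_comm]
  have hpos : (conjDiag U (fun i => max (t i) 0)).PosSemidef :=
    conjDiag_posSemidef U fun i => le_max_right _ _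
  have hneg : (conjDiag U (fun i => max (-t i) 0)).PosSemidef :=
    conjDiag_posSemidef U fun i => le_max_right _ _
  set Tp := conjDiag U (fun i => max (t i) 0)
  set Tm := conjDiag U (fun i => max (-t i) 0)
  have hTs : X - Y = Tp - Tm := by
    rw [hTU, conjDiag_sub]; congr 1; ext i
    rcases le_total (t i) 0 with h | h <;> simp [h]
  have hTWs : W * (X - Y) = Tp + Tm := by
    have : Tp + Tm = conjDiag U (fun i => max (t i) 0) - conjDiag U (fun i => -max (-t i) 0) := by
      have hz : Tm = -conjDiag U (fun i => -max (-t i) 0) := by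
        have := conjDiag_smul U (-1) (fun i => -max (-t i) 0)
        simp only [Complex.ofReal_neg, Complex.ofReal_one, neg_smul, one_smul] at this
        rw [← this]
        simp only [Tm]
        congr 1; ext i; simp
      rw [hz]; abel
    rw [this, hTU, conjDiag_mul hU, conjDiag_sub]
    congr 1; ext i
    simp only [hs, Pi.mul_apply, Pi.sub_apply]
    split_ifs with h
    · simp [h]
    · have h := le_of_lt (not_le.mp h)
      simp [h]
  -- Symmetrize: `2(X² - Y²) = (X - Y)(X + Y) + (X + Y)(X - Y)`, and `W` commutes with `X - Y`.
  have e1 : 2 • ((X * X - Y * Y) * W).trace = 2 • ((X + Y) * (Tp + Tm)).trace := by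
    have e : 2 • (X * X - Y * Y) = (X - Y) * (X + Y) + (X + Y) * (X - Y) := by
      rw [two_smul]; noncomm_ring
    rw [← trace_smul, ← Matrix.smul_mul, e, Matrix.add_mul, trace_add, Matrix.mul_assoc,
      Matrix.mul_assoc, hTW, hTWs, trace_mul_comm (X - Y), Matrix.mul_assoc, hTWs, two_smul]
  have e2 : ((X * X - Y * Y) * W).trace = ((X + Y) * (Tp + Tm)).trace := by
    simpa using e1
  have e3 : (hsSq (X - Y) : ℂ) = ((X - Y) * (Tp - Tm)).trace := by
    rw [← trace_conjTranspose_mul_self, hT.eq, ← hTs]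
  -- The excess of the tested trace over `hsSq (X - Y)` consists of traces of products of positive
  -- matrices.
  have e4 : ((X + Y) * (Tp + Tm)).trace - ((X - Y) * (Tp - Tm)).trace
      = 2 * (Y * Tp).trace + 2 * (X * Tm).trace := by
    simp only [Matrix.add_mul, Matrix.sub_mul, Matrix.mul_add, Matrix.mul_sub, trace_add, trace_sub]
    ring
  have e5 := congrArg Complex.re e4
  rw [← e3, ← e2] at e5
  simp only [Complex.sub_re, Complex.add_re, Complex.mul_re, Complex.re_ofNat, Complex.im_ofNat,
    zero_mul, sub_zero, Complex.ofReal_re] at e5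
  have h1 := trace_mul_re_nonneg hY hpos
  have h2 := trace_mul_re_nonneg hX hneg
  have h3 := (Complex.re_le_norm _).trans (h W hW1)
  linarith

lemma norm_le_one_of_posSemidef {S : Matrix n n ℂ} (hS : S.PosSemidef)
    (hS1 : (1 - S).PosSemidef) : ‖S‖ ≤ 1 := by
  open scoped MatrixOrder in
  exact (CStarAlgebra.norm_le_one_iff_of_nonneg S (nonneg_iff_posSemidef.mpr hS)).mpr
    (le_iff.mpr hS1)

/-- Replacing the weight `r` by `h` in `r S r`, for a contraction `S`. -/
lemma traceNormLE_weight_change {r h S : Matrix n n ℂ} (hr : r.PosSemidef) (hh : h.PosSemidef)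
    (hS : ‖S‖ ≤ 1) (hr1 : hsSq r ≤ 1) {c : ℝ} (hc : TraceNormLE (h * h - r * r) c) (hc1 : c ≤ 1) :
    TraceNormLE (r * S * r - h * S * h) (3 * √c) := by
  have hps : hsSq (r - h) ≤ c := by
    refine hsSq_sub_le_of_traceNormLE hr hh ?_
    have := hc.neg
    rwa [neg_sub] at this
  -- In fact `hsSq h ≤ hsSq r + c ≤ 2`; the bound `2` on the root is only convenient.
  have hh4 : √(hsSq h) ≤ 2 := by
    have h1 := trace_conjTranspose_mul_self h
    have h2 := trace_conjTranspose_mul_self r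
    rw [hh.1.eq] at h1
    rw [hr.1.eq] at h2
    have h3 := (Complex.re_le_norm _).trans hc.norm_trace_le
    rw [trace_sub, h1, h2, ← Complex.ofReal_sub, Complex.ofReal_re] at h3
    rw [Real.sqrt_le_left (by norm_num)]
    linarith
  have e : r * S * r - h * S * h = (r * S) * (r - h) + (r - h) * (S * h) := by noncomm_ring
  rw [e]
  refine ((TraceNormLE.of_mul _ _).add (TraceNormLE.of_mul _ _)).mono ?_
  have b1 : √(hsSq (r * S)) ≤ 1 := Real.sqrt_le_one.mpr ((hsSq_mul_contraction hS r).trans hr1)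
  have b2 : √(hsSq (S * h)) ≤ 2 := (Real.sqrt_le_sqrt (hsSq_contraction_mul hS h)).trans hh4
  have b3 : √(hsSq (r - h)) ≤ √c := Real.sqrt_le_sqrt hps
  calc _ ≤ 1 * √c + √c * 2 := by gcongr
    _ = 3 * √c := by ring

end MatrixAnalysis

end QMeas

namespace QMeas

open Matrix

/-- The largest eigenvalue of `Zᴴ Z` is at most the sum of all of them. -/
lemma norm_sq_le_hsSq {n : Type*} [Fintype n] [DecidableEq n] (Z : Matrix n n ℂ) :
    ‖Z‖ ^ 2 ≤ hsSq Z := by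
  rw [sq, ← l2_opNorm_conjTranspose_mul_self]
  have hZ : (Zᴴ * Z).PosSemidef := posSemidef_conjTranspose_mul_self Z
  obtain ⟨U, t, hU, hA, -, ht⟩ := exists_conjDiag hZ.1
  have ht0 : ∀ i, 0 ≤ t i := fun i => ht ▸ hZ.eigenvalues_nonneg i
  have h := trace_conjTranspose_mul_self Z
  rw [hA] at h ⊢
  rw [trace_conjDiag hU] at h
  have h' : ∑ i, t i = hsSq Z := Complex.ofReal_injective h
  refine norm_conjDiag_le hU (hsSq_nonneg Z) fun i => ?_
  rw [abs_of_nonneg (ht0 i), ← h']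
  exact Finset.single_le_sum (fun i _ => ht0 i) (Finset.mem_univ i)

/-- The operator norm is at most the trace norm. -/
lemma TraceNormLE.norm_le {n : Type*} [Fintype n] [DecidableEq n] {Z : Matrix n n ℂ} {c : ℝ}
    (h : TraceNormLE Z c) : ‖Z‖ ≤ c := by
  rcases eq_or_ne Z 0 with rfl | hZ
  · simpa using h.nonneg
  have hpos : 0 < ‖Z‖ := norm_pos_iff.mpr hZ
  -- Testing on `Zᴴ / ‖Z‖` gives `hsSq Z ≤ ‖Z‖ c`, while `‖Z‖² ≤ hsSq Z`.
  have h1 := h ((‖Z‖⁻¹ : ℂ) • Zᴴ) (by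
    rw [norm_smul, l2_opNorm_conjTranspose]
    simp [hpos.ne'])
  rw [Matrix.mul_smul, trace_smul, trace_mul_comm, trace_conjTranspose_mul_self, smul_eq_mul,
    norm_mul] at h1
  simp only [norm_inv, Complex.norm_real, norm_norm, Real.norm_of_nonneg (hsSq_nonneg Z)] at h1
  have h2 := norm_sq_le_hsSq Z
  rw [inv_mul_le_iff₀ hpos] at h1
  nlinarith

/-! ### Tensor products of matrices and their spectral decompositions. -/

section TensorProd

variable {κ : Type*} [Fintype κ] {d : ℕ}

lemma tensorProd_mul [DecidableEq κ] (B C : κ → Matrix (Fin d) (Fin d) ℂ) :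
    tensorProd B * tensorProd C = tensorProd fun k => B k * C k := by
  ext x y
  simp only [tensorProd, mul_apply, of_apply, Finset.prod_univ_sum, Fintype.piFinset_univ,
    Finset.prod_mul_distrib]

lemma tensorProd_one : tensorProd (fun _ : κ => (1 : Matrix (Fin d) (Fin d) ℂ)) = 1 := by
  ext x y
  simp only [tensorProd, of_apply, one_apply, Finset.prod_ite_zero, Finset.prod_const_one,
    Finset.mem_univ, true_implies, funext_iff]

lemma conjTranspose_tensorProd (B : κ → Matrix (Fin d) (Fin d) ℂ) :
    (tensorProd B)ᴴ = tensorProd fun k => (B k)ᴴ := by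
  ext x y
  simp [tensorProd, conjTranspose_apply]

lemma trace_tensorProd [DecidableEq κ] (B : κ → Matrix (Fin d) (Fin d) ℂ) :
    (tensorProd B).trace = ∏ k, (B k).trace := by
  simp only [trace, diag, tensorProd, of_apply, Finset.prod_univ_sum, Fintype.piFinset_univ]

lemma tensorProd_diagonal (f : κ → Fin d → ℂ) :
    tensorProd (fun k => diagonal (f k)) = diagonal fun x => ∏ k, f k (x k) := by
  ext x y
  simp only [tensorProd, of_apply, diagonal_apply, Finset.prod_ite_zero,
    Finset.mem_univ, true_implies, funext_iff]

lemma tensorProd_conjDiag [DecidableEq κ] (U : κ → Matrix (Fin d) (Fin d) ℂ) (f : κ → Fin d → ℝ) :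
    tensorProd (fun k => conjDiag (U k) (f k)) =
      conjDiag (tensorProd U) fun x => ∏ k, f k (x k) := by
  simp only [conjDiag, conjTranspose_tensorProd, Complex.ofReal_prod]
  rw [← tensorProd_diagonal fun k i => (f k i : ℂ), tensorProd_mul, tensorProd_mul]

lemma tensorProd_unitary [DecidableEq κ] {U : κ → Matrix (Fin d) (Fin d) ℂ}
    (hU : ∀ k, (U k)ᴴ * U k = 1) :
    (tensorProd U)ᴴ * tensorProd U = 1 := by
  rw [conjTranspose_tensorProd, tensorProd_mul]
  simp only [hU, tensorProd_one]

lemma tensorProd_posSemidef [DecidableEq κ] {B : κ → Matrix (Fin d) (Fin d) ℂ}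
    (hB : ∀ k, (B k).PosSemidef) :
    (tensorProd B).PosSemidef := by
  choose C hC _ using fun k => exists_conjTranspose_mul_self (hB k)
  rw [funext hC, ← tensorProd_mul, ← conjTranspose_tensorProd]
  exact posSemidef_conjTranspose_mul_self _

lemma sum_piFinset_tensorProd [DecidableEq κ] {m : ℕ} (s : κ → Finset (Fin m))
    (a : Fin m → Matrix (Fin d) (Fin d) ℂ) :
    ∑ J ∈ Fintype.piFinset s, tensorProd (fun k => a (J k)) =
      tensorProd fun k => ∑ i ∈ s k, a i := by
  ext x y
  simp only [tensorProd, Matrix.sum_apply, of_apply, Finset.prod_univ_sum]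

end TensorProd

/-! ### Partial traces and restrictions to few tensor factors. -/

section PartialTrace

open scoped Kronecker

variable {l d m : ℕ} (K : Finset (Fin l))

/-- The splitting of the product basis into the factors inside and outside `K`. -/
def splitEquiv : (Fin l → Fin d) ≃ (K → Fin d) × ({k : Fin l // k ∉ K} → Fin d) :=
  Equiv.piEquivPiSubtypeProd (fun k => k ∈ K) fun _ => Fin d

lemma splitEquiv_symm_apply (x : K → Fin d) (z : {k : Fin l // k ∉ K} → Fin d) :
    (splitEquiv K).symm (x, z) = glue K x z := rfl

lemma splitEquiv_glue (x : K → Fin d) (z : {k : Fin l // k ∉ K} → Fin d) :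
    splitEquiv K (glue K x z) = (x, z) := by
  rw [← splitEquiv_symm_apply, Equiv.apply_symm_apply]

/-- The operator `A ⊗ B` with `A` acting on the factors in `K` and `B` on the others. -/
def split (A : Matrix (K → Fin d) (K → Fin d) ℂ)
    (B : Matrix ({k : Fin l // k ∉ K} → Fin d) ({k : Fin l // k ∉ K} → Fin d) ℂ) :
    Matrix (Fin l → Fin d) (Fin l → Fin d) ℂ :=
  (A ⊗ₖ B).submatrix (splitEquiv K) (splitEquiv K)

lemma split_mul (A A' : Matrix (K → Fin d) (K → Fin d) ℂ)
    (B B' : Matrix ({k : Fin l // k ∉ K} → Fin d) ({k : Fin l // k ∉ K} → Fin d) ℂ) :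
    split K A B * split K A' B' = split K (A * A') (B * B') := by
  rw [split, split, submatrix_mul_equiv, ← mul_kronecker_mul, split]

lemma tensorProd_eq_split (B : Fin l → Matrix (Fin d) (Fin d) ℂ) :
    tensorProd B = split K (tensorProd fun k : K => B k)
      (tensorProd fun k : {k : Fin l // k ∉ K} => B k) := by
  ext x y
  simp only [tensorProd, split, of_apply, submatrix_apply, kroneckerMap_apply]
  refine (Fintype.prod_subtype_mul_prod_subtype (fun k => k ∈ K)
    fun k => B k (x k) (y k)).symm.trans ?_
  congr!

lemma partialTrace_split (A : Matrix (K → Fin d) (K → Fin d) ℂ)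
    (B : Matrix ({k : Fin l // k ∉ K} → Fin d) ({k : Fin l // k ∉ K} → Fin d) ℂ) :
    partialTrace K (split K A B) = B.trace • A := by
  ext x y
  simp only [partialTrace, split, of_apply, submatrix_apply, splitEquiv_glue, kroneckerMap_apply,
    Matrix.smul_apply, trace, diag, smul_eq_mul, Finset.sum_mul]
  exact Finset.sum_congr rfl fun z _ => mul_comm _ _

/-- The partial trace is dual to `W ↦ W ⊗ 1`; bounds on the factors in `K` thereby become tests on
the whole system. -/
lemma trace_partialTrace_mul (Z : Matrix (Fin l → Fin d) (Fin l → Fin d) ℂ)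
    (W : Matrix (K → Fin d) (K → Fin d) ℂ) :
    (partialTrace K Z * W).trace = (Z * split K W 1).trace := by
  simp only [trace, diag, mul_apply, partialTrace, split, of_apply, submatrix_apply]
  rw [← (splitEquiv K).symm.sum_comp, Fintype.sum_prod_type]
  refine Finset.sum_congr rfl fun x _ => ?_
  have : ∀ z, ∑ v, Z ((splitEquiv K).symm (x, z)) v *
      (W ⊗ₖ (1 : Matrix ({k : Fin l // k ∉ K} → Fin d) _ ℂ)) (splitEquiv K v)
        (splitEquiv K ((splitEquiv K).symm (x, z))) =
      ∑ y, Z (glue K x z) (glue K y z) * W y x := by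
    intro z
    rw [← (splitEquiv K).symm.sum_comp, Fintype.sum_prod_type]
    refine Finset.sum_congr rfl fun y _ => ?_
    simp [splitEquiv_symm_apply, splitEquiv_glue, one_apply]
  rw [Finset.sum_congr rfl fun z _ => this z, Finset.sum_comm]
  simp only [Finset.sum_mul]

/-- The inclusion `W ↦ W ⊗ 1` as a homomorphism of star algebras. -/
def inclusion : Matrix (K → Fin d) (K → Fin d) ℂ →⋆ₐ[ℂ]
    Matrix (Fin l → Fin d) (Fin l → Fin d) ℂ where
  toFun W := split K W 1
  map_one' := by simp [split]
  map_mul' A B := by rw [split_mul, Matrix.mul_one]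
  map_zero' := by simp [split]
  map_add' A B := by rw [split, add_kronecker]; rfl
  commutes' c := by
    rw [Algebra.algebraMap_eq_smul_one, Algebra.algebraMap_eq_smul_one, split, smul_kronecker,
      one_kronecker_one]
    ext x y
    simp [one_apply]
  map_star' A := by
    simp only [split, star_eq_conjTranspose, conjTranspose_submatrix, conjTranspose_kronecker,
      conjTranspose_one]

/-- A homomorphism of C*-algebras is contractive. -/
lemma norm_split_one_le (W : Matrix (K → Fin d) (K → Fin d) ℂ) : ‖split K W 1‖ ≤ ‖W‖ :=
  NonUnitalStarAlgHom.norm_apply_le (inclusion K) W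

/-- The partial trace weighted by `ρ` outside `K` is controlled by the trace norm weighted
by `ρ` on all factors. -/
lemma norm_partialTrace_le {U : Matrix (Fin d) (Fin d) ℂ} (hU : Uᴴ * U = 1) {p : Fin d → ℝ}
    {q : ℝ} (hq : 0 < q) (hp : ∀ i, q ≤ p i) (Y : Matrix (Fin l → Fin d) (Fin l → Fin d) ℂ)
    {c : ℝ}
    (hY : TraceNormLE (tensorProd (fun _ : Fin l => conjDiag U fun i => √(p i)) * Y *
      tensorProd (fun _ : Fin l => conjDiag U fun i => √(p i))) c) :
    ‖partialTrace K (tensorProd (fun k => if k ∈ K then 1 else conjDiag U p) * Y)‖ ≤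
      (q⁻¹) ^ K.card * c := by
  set w := conjDiag U fun i => √(p i) with hw
  set s := conjDiag U fun i => (√(p i))⁻¹ with hs
  have hp0 : ∀ i, 0 < p i := fun i => hq.trans_le (hp i)
  have hws : w * s = 1 := by
    rw [hw, hs, conjDiag_mul hU, ← conjDiag_one hU]
    congr 1; ext i
    exact mul_inv_cancel₀ (Real.sqrt_pos.mpr (hp0 i)).ne'
  have hww : w * w = conjDiag U p := by
    rw [hw, conjDiag_mul hU]
    congr 1; ext i
    exact Real.mul_self_sqrt (hp0 i).le
  set sK := tensorProd fun _ : K => s with hsK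
  set wK := tensorProd fun _ : K => w with hwK
  set wC := tensorProd fun _ : {k : Fin l // k ∉ K} => w with hwC
  set r := tensorProd fun _ : Fin l => w with hr
  have hr' : r = split K wK wC := tensorProd_eq_split K _
  have hwsK : wK * sK = 1 := by rw [hwK, hsK, tensorProd_mul]; simp only [hws, tensorProd_one]
  have hswK : sK * wK = 1 := mul_eq_one_comm.mp hwsK
  have hE : tensorProd (fun k => if k ∈ K then 1 else conjDiag U p) = split K 1 (wC * wC) := by
    rw [tensorProd_eq_split K, hwC, tensorProd_mul, hww]
    congr 1
    · rw [← tensorProd_one]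
      congr 1; ext1 k; simp
    · congr 1; ext1 k; simp [k.2]
  have hsn : ‖sK‖ ^ 2 ≤ (q⁻¹) ^ K.card := by
    have hsqrt : ‖sK‖ ≤ ((√q)⁻¹) ^ K.card := by
      rw [hsK, hs, tensorProd_conjDiag]
      refine norm_conjDiag_le (tensorProd_unitary fun _ => hU) (by positivity) fun x => ?_
      rw [Finset.abs_prod]
      calc ∏ k : K, |(√(p (x k)))⁻¹| ≤ ∏ _k : K, (√q)⁻¹ := by
            refine Finset.prod_le_prod (fun _ _ => abs_nonneg _) fun k _ => ?_
            rw [abs_of_nonneg (by positivity)]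
            exact inv_anti₀ (Real.sqrt_pos.mpr hq) (Real.sqrt_le_sqrt (hp _))
        _ = _ := by simp
    calc ‖sK‖ ^ 2 ≤ (((√q)⁻¹) ^ K.card) ^ 2 := pow_le_pow_left₀ (norm_nonneg _) hsqrt 2
      _ = (q⁻¹) ^ K.card := by rw [← pow_mul, mul_comm, pow_mul, inv_pow, Real.sq_sqrt hq.le]
  refine TraceNormLE.norm_le fun W hW => ?_
  set C := (q⁻¹) ^ K.card with hC
  have hC0 : 0 < C := by positivity
  -- On `K` the missing weight is supplied as `w s = 1`, with `s` the inverse of `w = √ρ`. Its price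
  -- is `‖sK‖² ≤ q^{-|K|}`.
  have key : split K W 1 * split K 1 (wC * wC) = r * split K (sK * W * sK) 1 * r := by
    rw [hr', split_mul, split_mul, split_mul]
    congr 1
    · rw [Matrix.mul_one, Matrix.mul_assoc wK, Matrix.mul_assoc (sK * W), hswK, Matrix.mul_one,
        ← Matrix.mul_assoc, hwsK, Matrix.one_mul]
    · simp
  have e : (partialTrace K (split K 1 (wC * wC) * Y) * W).trace =
      ((r * Y * r) * split K (sK * W * sK) 1).trace := by
    rw [trace_partialTrace_mul, Matrix.mul_assoc, trace_mul_comm, Matrix.mul_assoc, key,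
      trace_mul_comm, Matrix.mul_assoc r, Matrix.mul_assoc r, trace_mul_comm r]
    simp only [Matrix.mul_assoc]
    rw [trace_mul_comm]
    simp only [Matrix.mul_assoc]
  have hn : ‖sK * W * sK‖ ≤ C := by
    calc ‖sK * W * sK‖ ≤ ‖sK‖ * ‖W‖ * ‖sK‖ :=
          (l2_opNorm_mul _ _).trans (by gcongr; exact l2_opNorm_mul _ _)
      _ ≤ ‖sK‖ * 1 * ‖sK‖ := by gcongr
      _ ≤ C := by rw [mul_one, ← sq]; exact hsn
  have h1 := hY ((C⁻¹ : ℂ) • split K (sK * W * sK) 1) (by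
    rw [norm_smul]
    simp only [norm_inv, Complex.norm_real, Real.norm_of_nonneg hC0.le]
    rw [inv_mul_le_iff₀ hC0, mul_one]
    exact (norm_split_one_le K _).trans hn)
  rw [Matrix.mul_smul, trace_smul, smul_eq_mul, norm_mul] at h1
  simp only [norm_inv, Complex.norm_real, Real.norm_of_nonneg hC0.le] at h1
  rw [inv_mul_le_iff₀ hC0] at h1
  rwa [hE, e]

lemma filter_eq_piFinset (j : K → Fin m) :
    (Finset.univ.filter fun J : Fin l → Fin m => ∀ k : K, J k = j k) =
      Fintype.piFinset fun k => if h : k ∈ K then {j ⟨k, h⟩} else Finset.univ := by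
  ext J
  simp only [Finset.mem_filter, Finset.mem_univ, true_and, Fintype.mem_piFinset, Subtype.forall]
  refine forall_congr' fun k => ?_
  by_cases h : k ∈ K <;> simp [h]

lemma sum_filter_tensorProd {a : Fin m → Matrix (Fin d) (Fin d) ℂ} (j : K → Fin m) :
    ∑ J : Fin l → Fin m with ∀ k : K, J k = j k, tensorProd (fun k => a (J k)) =
      tensorProd fun k => if h : k ∈ K then a (j ⟨k, h⟩) else ∑ i, a i := by
  rw [filter_eq_piFinset, sum_piFinset_tensorProd]
  congr 1; ext1 k
  split_ifs <;> simp

/-- The restriction of a product POVM is the product POVM. -/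
lemma partialTrace_product {ρ : Matrix (Fin d) (Fin d) ℂ} (hρ1 : ρ.trace = 1)
    {a : Fin m → Matrix (Fin d) (Fin d) ℂ} (ha : ∑ i, a i = 1) (j : K → Fin m) :
    partialTrace K (tensorProd (fun k => if k ∈ K then 1 else ρ) *
      ∑ J : Fin l → Fin m with ∀ k : K, J k = j k, tensorProd (fun k => a (J k))) =
      tensorProd fun k : K => a (j k) := by
  rw [sum_filter_tensorProd, tensorProd_mul, tensorProd_eq_split K, partialTrace_split,
    trace_tensorProd]
  have h1 : ∀ k : {k : Fin l // k ∉ K}, ((if (k : Fin l) ∈ K then 1 else ρ) *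
      (if h : (k : Fin l) ∈ K then a (j ⟨k, h⟩) else ∑ i, a i)).trace = 1 := by
    intro k
    simp [k.2, ha, hρ1]
  rw [Finset.prod_congr rfl fun k _ => h1 k, Finset.prod_const_one, one_smul]
  congr 1; ext1 k
  simp

end PartialTrace

end QMeas

namespace QMeas

open Matrix

/-! ### Derandomized sampling by second moments. -/

section Sampling

variable {ι : Type*} [Fintype ι]

/-- A finite probability distribution is carried by some sequence along which a centred vector
valued function behaves as well as independent samples do in mean square. -/
lemma exists_norm_sum_sq_le_of_centred {E : Type*} [NormedAddCommGroup E] [InnerProductSpace ℝ E]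
    {P : ι → ℝ} (hP : ∀ i, 0 ≤ P i) (hP1 : ∑ i, P i = 1) {Z : ι → E} (hZ : ∑ i, P i • Z i = 0)
    (N : ℕ) : ∃ J : Fin N → ι, ‖∑ μ, Z (J μ)‖ ^ 2 ≤ N * ∑ i, P i * ‖Z i‖ ^ 2 := by
  induction N with
  | zero => exact ⟨Fin.elim0, by simp⟩
  | succ N ih =>
    obtain ⟨J, hJ⟩ := ih
    set S := ∑ μ, Z (J μ)
    set V := ∑ i, P i * ‖Z i‖ ^ 2
    -- The cross term vanishes since `Z` is centred, so some next sample adds at most the variance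
    -- to the squared norm.
    have hmean : ∑ i, P i * ‖Z i + S‖ ^ 2 = V + ‖S‖ ^ 2 := by
      have h1 : ∀ i, P i * ‖Z i + S‖ ^ 2 =
          P i * ‖Z i‖ ^ 2 + 2 * inner ℝ (P i • Z i) S + P i * ‖S‖ ^ 2 := by
        intro i
        rw [norm_add_sq_real, real_inner_smul_left]; ring
      rw [Finset.sum_congr rfl fun i _ => h1 i, Finset.sum_add_distrib, Finset.sum_add_distrib,
        ← Finset.mul_sum, ← sum_inner, hZ, inner_zero_left, ← Finset.sum_mul, hP1]
      ring
    have hex : ∃ i, ‖Z i + S‖ ^ 2 ≤ V + ‖S‖ ^ 2 := by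
      by_contra! hcon
      obtain ⟨i₀, -, hi₀⟩ : ∃ i ∈ Finset.univ, 0 < P i :=
        Finset.exists_lt_of_sum_lt (by rw [hP1]; simp)
      have : ∑ i, P i * (V + ‖S‖ ^ 2) < ∑ i, P i * ‖Z i + S‖ ^ 2 :=
        Finset.sum_lt_sum (fun i _ => mul_le_mul_of_nonneg_left (hcon i).le (hP i))
          ⟨i₀, Finset.mem_univ _, mul_lt_mul_of_pos_left (hcon i₀) hi₀⟩
      rw [← Finset.sum_mul, hP1, hmean, one_mul] at this
      exact lt_irrefl _ this
    obtain ⟨i, hi⟩ := hex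
    refine ⟨Fin.cons i J, ?_⟩
    rw [Fin.sum_univ_succ]
    simp only [Fin.cons_zero, Fin.cons_succ]
    push_cast
    linarith

/-- Subtracting the mean can only lower the mean square, so the raw second moment bounds the
variance. -/
lemma exists_norm_sum_sub_sq_le {E : Type*} [NormedAddCommGroup E] [InnerProductSpace ℝ E]
    {P : ι → ℝ} (hP : ∀ i, 0 ≤ P i) (hP1 : ∑ i, P i = 1) (Y : ι → E) (N : ℕ) :
    ∃ J : Fin N → ι, ‖∑ μ, Y (J μ) - (N : ℝ) • ∑ i, P i • Y i‖ ^ 2 ≤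
      N * ∑ i, P i * ‖Y i‖ ^ 2 := by
  set e := ∑ i, P i • Y i with he
  have hZ : ∑ i, P i • (Y i - e) = 0 := by
    simp only [smul_sub, Finset.sum_sub_distrib, ← Finset.sum_smul, hP1, one_smul]
    rw [← he, sub_self]
  obtain ⟨J, hJ⟩ := exists_norm_sum_sq_le_of_centred hP hP1 hZ N
  refine ⟨J, ?_⟩
  have e1 : ∑ μ, (Y (J μ) - e) = ∑ μ, Y (J μ) - (N : ℝ) • e := by
    rw [Finset.sum_sub_distrib]; simp [Nat.cast_smul_eq_nsmul]
  rw [e1] at hJ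
  refine hJ.trans (mul_le_mul_of_nonneg_left ?_ (Nat.cast_nonneg _))
  have h1 : ∀ i, P i * ‖Y i - e‖ ^ 2 =
      P i * ‖Y i‖ ^ 2 - 2 * inner ℝ (P i • Y i) e + P i * ‖e‖ ^ 2 := by
    intro i
    rw [norm_sub_sq_real, real_inner_smul_left]; ring
  rw [Finset.sum_congr rfl fun i _ => h1 i, Finset.sum_add_distrib, Finset.sum_sub_distrib,
    ← Finset.mul_sum, ← sum_inner, ← he, ← Finset.sum_mul, hP1, real_inner_self_eq_norm_sq]
  nlinarith [sq_nonneg ‖e‖]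

/-- Sampling matrices so that many conditional averages are simultaneously approximated in
Hilbert–Schmidt norm. -/
lemma exists_hsSq_sum_le {n I : Type*} [Fintype n] [Fintype I]
    {P : ι → ℝ} (hP : ∀ i, 0 ≤ P i) (hP1 : ∑ i, P i = 1) (X : ι → Matrix n n ℂ) {t : ℝ}
    (hX : ∀ i, hsSq (X i) ≤ t) (E : I → ι → Prop) [∀ i, DecidablePred (E i)] (N : ℕ) :
    ∃ J : Fin N → ι, ∀ i, hsSq (∑ μ with E i (J μ), X (J μ) -
      (N : ℂ) • ∑ j with E i j, (P j : ℂ) • X j) ≤ N * (Fintype.card I * t) := by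
  -- All conditional sums are stacked into one Euclidean vector, so a single choice of samples
  -- serves every event, at the cost of the factor `card I`.
  set Y : ι → PiLp 2 (fun _ : I × n × n => ℂ) := fun j =>
    WithLp.toLp 2 fun x => if E x.1 j then X j x.2.1 x.2.2 else 0 with hY
  have hYn : ∀ j, ‖Y j‖ ^ 2 ≤ Fintype.card I * t := by
    intro j
    rw [PiLp.norm_sq_eq_of_L2, Fintype.sum_prod_type]
    calc _ ≤ ∑ _i : I, t := Finset.sum_le_sum fun i _ => ?_
      _ = _ := by simp
    refine le_trans ?_ (hX j)
    rw [Fintype.sum_prod_type, hsSq]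
    refine Finset.sum_le_sum fun x _ => Finset.sum_le_sum fun y _ => ?_
    simp only [hY]
    split_ifs
    · exact le_rfl
    · simp
  obtain ⟨J, hJ⟩ := exists_norm_sum_sub_sq_le hP hP1 Y N
  refine ⟨J, fun i => ?_⟩
  have h2 : ∑ j, P j * ‖Y j‖ ^ 2 ≤ Fintype.card I * t :=
    calc _ ≤ ∑ j, P j * (Fintype.card I * t) :=
          Finset.sum_le_sum fun j _ => mul_le_mul_of_nonneg_left (hYn j) (hP j)
      _ = _ := by rw [← Finset.sum_mul, hP1, one_mul]
  refine le_trans ?_ (hJ.trans (mul_le_mul_of_nonneg_left h2 (Nat.cast_nonneg _)))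
  rw [PiLp.norm_sq_eq_of_L2, Fintype.sum_prod_type]
  refine le_trans (le_of_eq ?_)
    (Finset.single_le_sum (fun i _ => Finset.sum_nonneg fun _ _ => by positivity)
      (Finset.mem_univ i))
  rw [Fintype.sum_prod_type, hsSq]
  refine Finset.sum_congr rfl fun x _ => Finset.sum_congr rfl fun y _ => ?_
  congr 2
  simp only [hY, Matrix.sum_apply, Finset.sum_filter, Matrix.sub_apply, Matrix.smul_apply,
    PiLp.sub_apply, PiLp.smul_apply, WithLp.ofLp_sum, Finset.sum_apply, smul_eq_mul,
    Complex.real_smul, Complex.ofReal_natCast]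
  congr 1
  · exact Finset.sum_congr rfl fun j _ => by split_ifs <;> rfl
  · congr 1
    exact Finset.sum_congr rfl fun j _ => by split_ifs <;> simp

end Sampling

/-! ### Chernoff bounds and the count of small subsets. -/

section Concentration

open Filter Topology

/-- An exponential large deviation bound on a finite probability space. -/
lemma exists_large_deviation_bound {α : Type*} [Fintype α] {Q : α → ℝ} (hQ : ∀ a, 0 ≤ Q a)
    (hQ1 : ∑ a, Q a = 1) (f : α → ℝ) {δ : ℝ} (hδ : 0 < δ) :
    ∃ r : ℝ, 0 ≤ r ∧ r < 1 ∧ ∀ l : ℕ,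
      ∑ x : Fin l → α with l * (∑ a, Q a * f a + δ) ≤ ∑ k, f (x k), ∏ k, Q (x k) ≤ r ^ l := by
  set M := ∑ a, Q a * f a + δ with hM
  set φ : ℝ → ℝ := fun s => ∑ a, Q a * Real.exp (s * (f a - M)) with hφ
  have hφ0 : φ 0 = 1 := by simp [hφ, hQ1]
  have hder : HasDerivAt φ (-δ) 0 := by
    have h : HasDerivAt φ (∑ a, Q a * (Real.exp (0 * (f a - M)) * (1 * (f a - M)))) 0 := by
      refine HasDerivAt.fun_sum fun a _ => ?_
      exact (((hasDerivAt_id (0 : ℝ)).mul_const (f a - M)).exp).const_mul (Q a)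
    convert h using 1
    simp only [zero_mul, Real.exp_zero, one_mul]
    simp only [mul_sub, Finset.sum_sub_distrib,
      ← Finset.sum_mul, hQ1]
    rw [hM]; ring
  -- The shifted moment generating function `φ` has `φ 0 = 1` and slope `-δ` at `0`, so it drops
  -- below `1` just to the right.
  obtain ⟨s, hs0, hs1⟩ : ∃ s : ℝ, 0 < s ∧ φ s < 1 := by
    have h1 := (hasDerivAt_iff_tendsto_slope.mp hder).mono_left
      (nhdsWithin_mono 0 (fun x (hx : x ∈ Set.Ioi (0 : ℝ)) => ne_of_gt hx))
    have h2 := (h1.eventually (gt_mem_nhds (neg_lt_zero.mpr hδ))).and self_mem_nhdsWithin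
    obtain ⟨s, hs, hs0⟩ := h2.exists
    refine ⟨s, hs0, ?_⟩
    rw [slope_def_field, sub_zero, div_lt_iff₀ hs0, hφ0] at hs
    linarith
  refine ⟨φ s, Finset.sum_nonneg fun a _ => mul_nonneg (hQ a) (Real.exp_pos _).le, hs1,
    fun l => ?_⟩
  calc _ ≤ ∑ x : Fin l → α with l * M ≤ ∑ k, f (x k),
        ∏ k, (Q (x k) * Real.exp (s * (f (x k) - M))) := by
        refine Finset.sum_le_sum fun x hx => ?_
        rw [Finset.prod_mul_distrib, ← Real.exp_sum, ← Finset.mul_sum, Finset.sum_sub_distrib]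
        refine le_mul_of_one_le_right (Finset.prod_nonneg fun k _ => hQ _) (Real.one_le_exp ?_)
        have := (Finset.mem_filter.mp hx).2
        simp only [Finset.sum_const, Finset.card_univ, Fintype.card_fin, nsmul_eq_mul]
        exact mul_nonneg hs0.le (by linarith)
    _ ≤ ∑ x : Fin l → α, ∏ k, (Q (x k) * Real.exp (s * (f (x k) - M))) :=
        Finset.sum_le_sum_of_subset_of_nonneg (Finset.filter_subset _ _) fun x _ _ =>
          Finset.prod_nonneg fun k _ => mul_nonneg (hQ _) (Real.exp_pos _).le
    _ = φ s ^ l := by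
        have := Finset.prod_univ_sum (fun _ : Fin l => (Finset.univ : Finset α))
          (fun _ a => Q a * Real.exp (s * (f a - M)))
        rw [Fintype.piFinset_univ] at this
        rw [← this]
        simp [hφ]

/-- By the binomial theorem the weights `x ^ |K|` of all subsets add up to `(x + 1) ^ l`, and each
small subset has weight at least `x ^ ν`. -/
lemma card_small_subsets_mul_pow_le (l ν : ℕ) {x : ℝ} (hx : 0 < x) (hx1 : x ≤ 1) :
    ((Finset.univ.filter fun K : Finset (Fin l) => K.card ≤ ν).card : ℝ) * x ^ ν ≤ (x + 1) ^ l := by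
  have h := Fintype.sum_pow_mul_eq_add_pow (Fin l) x 1
  simp only [one_pow, mul_one, Fintype.card_fin] at h
  rw [← h, ← nsmul_eq_mul, ← Finset.sum_const]
  refine (Finset.sum_le_sum fun K hK => ?_).trans
    (Finset.sum_le_sum_of_subset_of_nonneg (Finset.filter_subset _ _) fun K _ _ => by positivity)
  exact pow_le_pow_of_le_one hx.le hx1 (Finset.mem_filter.mp hK).2

/-- The number of subsets of size `o(l)` grows subexponentially. -/
lemma eventually_card_small_subsets_le {ν : ℕ → ℕ}
    (hν : Asymptotics.IsLittleO atTop (fun l : ℕ => (ν l : ℝ)) (fun l : ℕ => (l : ℝ)))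
    (B : ℝ) {γ : ℝ} (hγ : 0 < γ) :
    ∀ᶠ l : ℕ in atTop,
      ((Finset.univ.filter fun K : Finset (Fin l) => K.card ≤ ν l).card : ℝ) * B ^ ν l ≤
        Real.exp (γ * l) := by
  set x := min 1 (γ / 2) with hx
  have hx0 : 0 < x := lt_min one_pos (by linarith)
  set C := max 1 (|B| / x) with hC
  have hC1 : 1 ≤ C := le_max_left _ _
  have hlog : 0 ≤ Real.log C := Real.log_nonneg hC1
  -- The `+ 1` guards against `log C = 0`. Half of `γ` pays for `C ^ ν l`, the other half for `(x +
  -- 1) ^ l`.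
  have hev := hν.bound (c := γ / 2 / (Real.log C + 1)) (by positivity)
  filter_upwards [hev] with l hl
  simp only [Real.norm_natCast] at hl
  have h1 := card_small_subsets_mul_pow_le l (ν l) hx0 (min_le_left _ _)
  set n : ℝ := ((Finset.univ.filter fun K : Finset (Fin l) => K.card ≤ ν l).card : ℝ)
  have hn : 0 ≤ n := Nat.cast_nonneg _
  calc n * B ^ ν l ≤ n * |B| ^ ν l :=
        mul_le_mul_of_nonneg_left ((le_abs_self _).trans (abs_pow _ _).le) hn
    _ = (n * x ^ ν l) * (|B| / x) ^ ν l := by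
        rw [div_pow]; field_simp
    _ ≤ (x + 1) ^ l * C ^ ν l := by
        gcongr
        exact le_max_right _ _
    _ ≤ Real.exp x ^ l * Real.exp (Real.log C) ^ ν l := by
        rw [Real.exp_log (by linarith)]
        gcongr
        exact Real.add_one_le_exp x
    _ = Real.exp (l * x + ν l * Real.log C) := by
        rw [← Real.exp_nat_mul, ← Real.exp_nat_mul, Real.exp_add]
    _ ≤ Real.exp (γ * l) := by
        rw [Real.exp_le_exp]
        have h2 : (ν l : ℝ) * Real.log C ≤ γ / 2 * l := by
          calc (ν l : ℝ) * Real.log C ≤ γ / 2 / (Real.log C + 1) * l * (Real.log C + 1) := by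
                gcongr
                linarith
            _ = γ / 2 * l := by field_simp
        have h3 : (l : ℝ) * x ≤ l * (γ / 2) := by gcongr; exact min_le_right _ _
        linarith

end Concentration

end QMeas

namespace QMeas

open Matrix

/-! ### Covering an ensemble by few samples and normalizing to a POVM. -/

section Covering

variable {n ι I : Type*}

lemma hsSq_smul [Fintype n] (c : ℂ) (X : Matrix n n ℂ) : hsSq (c • X) = ‖c‖ ^ 2 * hsSq X := by
  simp only [hsSq, Matrix.smul_apply, smul_eq_mul, norm_mul, mul_pow, Finset.mul_sum]

lemma posSemidef_ofReal_smul {c : ℝ} (hc : 0 ≤ c) {X : Matrix n n ℂ} (hX : X.PosSemidef) :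
    ((c : ℂ) • X).PosSemidef := hX.smul (by simpa using hc)

lemma trace_re_nonneg [Fintype n] {X : Matrix n n ℂ} (hX : X.PosSemidef) : 0 ≤ X.trace.re :=
  (Complex.le_def.mp hX.trace_nonneg).1

variable [Fintype n] [DecidableEq n] [Fintype ι]

lemma conjDiag_posDef {U : Matrix n n ℂ} (hU : Uᴴ * U = 1) {f : n → ℝ} (hf : ∀ i, 0 < f i) :
    (conjDiag U f).PosDef := by
  rw [(conjDiag_posSemidef U fun i => (hf i).le).posDef_iff_isUnit]
  refine IsUnit.of_mul_eq_one (conjDiag U f⁻¹) ?_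
  rw [conjDiag_mul hU, ← conjDiag_one hU]
  congr 1; ext i
  exact mul_inv_cancel₀ (hf i).ne'

variable {P : ι → ℝ} {T G : ι → Matrix n n ℂ} {Q : Matrix n n ℂ} {t η τ : ℝ}

/-- Truncating each `T j` to `P j • Q (G j) Q` costs little in trace norm, uniformly over all
partial sums. -/
lemma traceNormLE_sum_sub_truncation (hP : ∀ j, 0 ≤ P j) (hG : ∀ j, (G j).PosSemidef)
    (hGT : ∀ j, (T j - (P j : ℂ) • G j).PosSemidef) (hR1 : (∑ j, T j).trace = 1)
    (hQ : Q.IsHermitian) (hQQ : Q * Q = Q) (hQ1 : ‖Q‖ ≤ 1)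
    (hη : (∑ j, (T j - (P j : ℂ) • G j)).trace.re ≤ η)
    (hη' : ((∑ j, T j) * (1 - Q)).trace.re ≤ η) (s : Finset ι) :
    TraceNormLE (∑ j ∈ s, T j - ∑ j ∈ s, (P j : ℂ) • (Q * G j * Q)) (2 * √η + η) := by
  classical
  set Gs := ∑ j ∈ s, (P j : ℂ) • G j with hGs
  have hPG : ∀ j, ((P j : ℂ) • G j).PosSemidef := fun j => posSemidef_ofReal_smul (hP j) (hG j)
  have hT : ∀ j, (T j).PosSemidef := fun j => by
    have := (hGT j).add (hPG j); rwa [sub_add_cancel] at this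
  have hGsp : Gs.PosSemidef := posSemidef_sum s fun j _ => hPG j
  have hcompl : (∑ j, T j - Gs).PosSemidef := by
    have : ∑ j, T j - Gs = ∑ j ∈ s, (T j - (P j : ℂ) • G j) + ∑ j ∈ sᶜ, T j := by
      rw [← Finset.sum_add_sum_compl s, hGs, Finset.sum_sub_distrib]; abel
    rw [this]
    exact (posSemidef_sum s fun j _ => hGT j).add (posSemidef_sum sᶜ fun j _ => hT j)
  have h1Q : (1 - Q).PosSemidef := by
    have hH : (1 - Q)ᴴ = 1 - Q := by rw [conjTranspose_sub, conjTranspose_one, hQ.eq]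
    have hid : (1 - Q) * (1 - Q) = 1 - Q := by
      rw [Matrix.sub_mul, Matrix.mul_sub, Matrix.mul_sub, hQQ]; simp
    have := posSemidef_conjTranspose_mul_self (1 - Q)
    rwa [hH, hid] at this
  have b1 : (Gs * (1 - Q)).trace.re ≤ η := by
    have := trace_mul_re_nonneg hcompl h1Q
    rw [Matrix.sub_mul, trace_sub, Complex.sub_re] at this
    linarith
  have b2 : Gs.trace.re ≤ 1 := by
    have := trace_re_nonneg hcompl
    rw [trace_sub, Complex.sub_re, hR1, Complex.one_re] at this
    linarith
  -- The compression loss is handled by gentle compression, the discarded eigenvalues by positivity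
  -- and their total trace.
  have e : ∑ j ∈ s, T j - ∑ j ∈ s, (P j : ℂ) • (Q * G j * Q) =
      (Gs - Q * Gs * Q) + ∑ j ∈ s, (T j - (P j : ℂ) • G j) := by
    have : Q * Gs * Q = ∑ j ∈ s, (P j : ℂ) • (Q * G j * Q) := by
      rw [hGs, Finset.mul_sum, Finset.sum_mul]
      simp
    rw [this, Finset.sum_sub_distrib]; abel
  rw [e]
  refine TraceNormLE.add ?_ ?_
  · refine (TraceNormLE.sub_compress hGsp hQ hQ1 hQQ).mono ?_
    have h2 : √(Gs.trace.re) ≤ 1 := Real.sqrt_le_one.mpr b2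
    have h1 : √((Gs * (1 - Q)).trace.re) ≤ √η := Real.sqrt_le_sqrt b1
    calc _ ≤ 2 * (√η * 1) := by gcongr
      _ = 2 * √η := by ring
  · refine (TraceNormLE.of_posSemidef (posSemidef_sum s fun j _ => hGT j)).mono (le_trans ?_ hη)
    rw [trace_sum, trace_sum, Complex.re_sum, Complex.re_sum]
    exact Finset.sum_le_sum_of_subset_of_nonneg (Finset.subset_univ s)
      fun j _ _ => trace_re_nonneg (hGT j)

/-- The truncated operators cannot all be small if they are to carry the whole trace. -/
lemma one_le_of_truncation (hP : ∀ j, 0 ≤ P j) (hP1 : ∑ j, P j = 1)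
    (hG : ∀ j, (G j).PosSemidef) (hGT : ∀ j, (T j - (P j : ℂ) • G j).PosSemidef)
    (hR1 : (∑ j, T j).trace = 1) (hQ : Q.IsHermitian) (hQQ : Q * Q = Q) (hQ1 : ‖Q‖ ≤ 1)
    (hη : (∑ j, (T j - (P j : ℂ) • G j)).trace.re ≤ η)
    (hη' : ((∑ j, T j) * (1 - Q)).trace.re ≤ η)
    (hGt : ∀ j, hsSq (G j) ≤ t) (hQτ : Q.trace.re ≤ τ) :
    1 ≤ 2 * √η + η + √τ * √t := by
  have h1 := (traceNormLE_sum_sub_truncation hP hG hGT hR1 hQ hQQ hQ1 hη hη'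
    Finset.univ).norm_trace_le
  have h2 := (Complex.re_le_norm _).trans h1
  have h3 : ∀ j, (Q * G j * Q).trace.re ≤ √τ * √t := by
    intro j
    have hx : Q * (Q * G j * Q) = Q * G j * Q := by rw [← Matrix.mul_assoc, ← Matrix.mul_assoc, hQQ]
    refine ((Complex.re_le_norm _).trans
      (TraceNormLE.of_proj_mul hQ hQQ hx).norm_trace_le).trans ?_
    gcongr
    exact ((hsSq_mul_contraction hQ1 _).trans (hsSq_contraction_mul hQ1 _)).trans (hGt j)
  have h4 : (∑ j, (P j : ℂ) • (Q * G j * Q)).trace.re ≤ √τ * √t := by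
    rw [trace_sum, Complex.re_sum]
    calc _ = ∑ j, P j * (Q * G j * Q).trace.re := by simp [trace_smul]
      _ ≤ ∑ j, P j * (√τ * √t) :=
          Finset.sum_le_sum fun j _ => mul_le_mul_of_nonneg_left (h3 j) (hP j)
      _ = √τ * √t := by rw [← Finset.sum_mul, hP1, one_mul]
  rw [trace_sub, hR1, Complex.sub_re, Complex.one_re] at h2
  linarith

/-- Few samples of the truncated operators reproduce all prescribed partial sums of `T` in trace
norm. A small multiple of `∑ j, T j` is mixed in to make the sum positive definite. -/
lemma exists_covering [Fintype I] (hP : ∀ j, 0 ≤ P j) (hP1 : ∑ j, P j = 1)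
    (hG : ∀ j, (G j).PosSemidef) (hGT : ∀ j, (T j - (P j : ℂ) • G j).PosSemidef)
    (hR : (∑ j, T j).PosDef)
    (hR1 : (∑ j, T j).trace = 1) (hQ : Q.IsHermitian) (hQQ : Q * Q = Q) (hQ1 : ‖Q‖ ≤ 1)
    (hη : (∑ j, (T j - (P j : ℂ) • G j)).trace.re ≤ η)
    (hη' : ((∑ j, T j) * (1 - Q)).trace.re ≤ η)
    (hGt : ∀ j, hsSq (G j) ≤ t) (hQτ : Q.trace.re ≤ τ)
    (E : I → ι → Prop) [∀ i, DecidablePred (E i)] {N : ℕ} (hN : 0 < N) {ζ : ℝ} (hζ : 0 < ζ) :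
    ∃ (J : Fin N → ι) (B : Fin N → Matrix n n ℂ), (∀ μ, (B μ).PosSemidef) ∧ (∑ μ, B μ).PosDef ∧
      ∀ i, TraceNormLE (∑ μ with E i (J μ), B μ - ∑ j with E i j, T j)
        (√τ * √(Fintype.card I * t / N) + ζ + (2 * √η + η)) := by
  set R := ∑ j, T j with hRdef
  set X : ι → Matrix n n ℂ := fun j => Q * G j * Q with hX
  have hXp : ∀ j, (X j).PosSemidef := fun j => by
    have := (hG j).mul_mul_conjTranspose_same Q
    rwa [hQ.eq] at this
  have hXt : ∀ j, hsSq (X j) ≤ t := fun j =>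
    ((hsSq_mul_contraction hQ1 _).trans (hsSq_contraction_mul hQ1 _)).trans (hGt j)
  obtain ⟨J, hJ⟩ := exists_hsSq_sum_le hP hP1 X hXt E N
  have hN0 : (0 : ℝ) < N := Nat.cast_pos.mpr hN
  have hNc : (N : ℂ) ≠ 0 := Nat.cast_ne_zero.mpr hN.ne'
  have hNi : (((N : ℝ)⁻¹ : ℝ) : ℂ) = (N : ℂ)⁻¹ := by push_cast; rfl
  refine ⟨J, fun μ => (((N : ℝ)⁻¹ : ℝ) : ℂ) • (X (J μ) + (ζ : ℂ) • R), fun μ => ?_, ?_, fun i => ?_⟩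
  · exact posSemidef_ofReal_smul (by positivity)
      ((hXp _).add (posSemidef_ofReal_smul hζ.le hR.posSemidef))
  · rw [← Finset.smul_sum, Finset.sum_add_distrib]
    refine PosDef.smul (PosDef.posSemidef_add (posSemidef_sum _ fun μ _ => hXp _) ?_) ?_
    · rw [Finset.sum_const, Finset.card_univ, Fintype.card_fin, ← Nat.cast_smul_eq_nsmul ℂ,
        smul_smul]
      refine hR.smul ?_
      rw [← Complex.ofReal_natCast, ← Complex.ofReal_mul]
      exact_mod_cast mul_pos hN0 hζ
    · exact_mod_cast inv_pos.mpr hN0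
  · set s := Finset.univ.filter (fun μ => E i (J μ)) with hs
    -- Three errors: sampling, the admixture of `R`, and truncation. The sampling error is fixed by
    -- `Q`, which gives the factor `√τ`.
    have e : ∑ μ ∈ s, (((N : ℝ)⁻¹ : ℝ) : ℂ) • (X (J μ) + (ζ : ℂ) • R) - ∑ j with E i j, T j =
        (N : ℂ)⁻¹ • (∑ μ ∈ s, X (J μ) - (N : ℂ) • ∑ j with E i j, (P j : ℂ) • X j) +
        (((N : ℝ)⁻¹ * s.card * ζ : ℝ) : ℂ) • R +
        -(∑ j with E i j, T j - ∑ j with E i j, (P j : ℂ) • X j) := by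
      rw [← Finset.smul_sum, Finset.sum_add_distrib, Finset.sum_const, smul_sub, smul_smul,
        inv_mul_cancel₀ hNc, one_smul, smul_add, hNi, ← Nat.cast_smul_eq_nsmul ℂ, smul_smul,
        smul_smul]
      push_cast
      abel
    rw [e]
    refine TraceNormLE.add (TraceNormLE.add ?_ ?_) ?_
    · have hQX : ∀ j, Q * X j = X j := fun j => by
        rw [hX]; simp only; rw [← Matrix.mul_assoc, ← Matrix.mul_assoc, hQQ]
      refine (TraceNormLE.of_proj_mul hQ hQQ ?_).mono ?_
      · simp only [Matrix.mul_smul, Matrix.mul_sub, Finset.mul_sum, hQX]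
      · gcongr
        rw [hsSq_smul, norm_inv, Complex.norm_natCast]
        calc ((N : ℝ)⁻¹) ^ 2 * _ ≤ ((N : ℝ)⁻¹) ^ 2 * (N * (Fintype.card I * t)) := by
              gcongr; exact hJ i
          _ = Fintype.card I * t / N := by field_simp
    · refine (TraceNormLE.of_posSemidef
        (posSemidef_ofReal_smul (by positivity) hR.posSemidef)).mono ?_
      rw [trace_smul, hR1, smul_eq_mul, mul_one, Complex.ofReal_re]
      have : (s.card : ℝ) ≤ N := by
        have := Finset.card_le_univ s
        rw [Fintype.card_fin] at this
        exact_mod_cast this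
      calc (N : ℝ)⁻¹ * s.card * ζ ≤ (N : ℝ)⁻¹ * N * ζ := by gcongr
        _ = ζ := by field_simp
    · exact (traceNormLE_sum_sub_truncation hP hG hGT hR1 hQ hQQ hQ1 hη hη' _).neg

/-- Normalizing a covering by the inverse square root of its sum yields a POVM. -/
lemma exists_povm_of_covering {N : ℕ} {J : Fin N → ι} {B : Fin N → Matrix n n ℂ}
    (hB : ∀ μ, (B μ).PosSemidef) (hσ : (∑ μ, B μ).PosDef) {r : Matrix n n ℂ} (hr : r.PosSemidef)
    (hr1 : (r * r).trace = 1) {S : ι → Matrix n n ℂ} (hS : ∑ j, S j = 1)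
    (E : I → ι → Prop) [∀ i, DecidablePred (E i)] {i₀ : I} (hi₀ : ∀ j, E i₀ j) {e : ℝ}
    (he1 : e ≤ 1)
    (he : ∀ i, TraceNormLE (∑ μ with E i (J μ), B μ - ∑ j with E i j, r * S j * r) e) :
    ∃ A : Fin N → Matrix n n ℂ, IsPOVM A ∧
      ∀ i, TraceNormLE (r * (∑ μ with E i (J μ), A μ - ∑ j with E i j, S j) * r)
        (3 * √e + e) := by
  obtain ⟨h, hh, hhh⟩ := exists_posSemidef_sqrt hσ.posSemidef
  have hdet : IsUnit h.det := by
    have h1 : IsUnit (h * h).det := by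
      rw [hhh]; exact (isUnit_iff_isUnit_det _).mp hσ.isUnit
    rw [det_mul] at h1
    exact isUnit_of_mul_isUnit_left h1
  have hinv : (h⁻¹)ᴴ = h⁻¹ := by rw [conjTranspose_nonsing_inv, hh.1.eq]
  have hApos : ∀ μ, (h⁻¹ * B μ * h⁻¹).PosSemidef := fun μ => by
    have := (hB μ).mul_mul_conjTranspose_same h⁻¹
    rwa [hinv] at this
  have hAsum : ∑ μ, h⁻¹ * B μ * h⁻¹ = 1 := by
    rw [← Finset.sum_mul, ← Finset.mul_sum, ← hhh, ← Matrix.mul_assoc, nonsing_inv_mul _ hdet,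
      Matrix.one_mul, mul_nonsing_inv _ hdet]
  refine ⟨fun μ => h⁻¹ * B μ * h⁻¹, ⟨hApos, hAsum⟩, fun i => ?_⟩
  set s := Finset.univ.filter (fun μ => E i (J μ)) with hs
  set A := ∑ μ ∈ s, h⁻¹ * B μ * h⁻¹ with hA
  have hA1 : ‖A‖ ≤ 1 := by
    refine norm_le_one_of_posSemidef (posSemidef_sum _ fun μ _ => hApos μ) ?_
    rw [← hAsum, ← Finset.sum_add_sum_compl s, hA, add_sub_cancel_left]
    exact posSemidef_sum _ fun μ _ => hApos μ
  have hhAh : h * A * h = ∑ μ ∈ s, B μ := by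
    rw [hA, ← Finset.sum_mul, ← Finset.mul_sum]
    simp only [Matrix.mul_assoc]
    rw [nonsing_inv_mul _ hdet, Matrix.mul_one, ← Matrix.mul_assoc, mul_nonsing_inv _ hdet,
      Matrix.one_mul]
  -- The event `i₀`, which always holds, compares the full sums.
  have hsum : TraceNormLE (h * h - r * r) e := by
    have := he i₀
    simp only [hi₀, Finset.filter_true] at this
    rwa [← Finset.sum_mul, ← Finset.mul_sum, hS, Matrix.mul_one, ← hhh] at this
  have hrs : hsSq r ≤ 1 := by
    have h1 := trace_conjTranspose_mul_self r
    rw [hr.1.eq, hr1] at h1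
    exact (Complex.ofReal_injective (by rw [← h1]; simp)).le
  -- Since `h A h` is the partial sum of the `B μ`, only replacing the weight `h` by `r` costs
  -- anything beyond the covering error.
  have e1 : r * (A - ∑ j with E i j, S j) * r =
      (r * A * r - h * A * h) + (∑ μ ∈ s, B μ - ∑ j with E i j, r * S j * r) := by
    rw [hhAh, ← Finset.sum_mul, ← Finset.mul_sum, Matrix.mul_sub, Matrix.sub_mul]
    abel
  rw [e1]
  exact (traceNormLE_weight_change hr hh hA1 hrs hsum he1).add (he i)

end Covering

end QMeas

namespace QMeas

open Matrix

/-! ### The product ensemble. -/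

section Product

variable {d m : ℕ}

/-- Spectral data of a state `ρ = U diag(p) U*` and of its canonical ensemble
`√ρ aⱼ √ρ = λⱼ Vⱼ diag(qⱼ) Vⱼ*` for a POVM `a`. -/
structure EnsembleData (a : Fin m → Matrix (Fin d) (Fin d) ℂ) where
  (U : Matrix (Fin d) (Fin d) ℂ)
  (p : Fin d → ℝ)
  (V : Fin m → Matrix (Fin d) (Fin d) ℂ)
  (lam : Fin m → ℝ)
  (q : Fin m → Fin d → ℝ)
  (unitary : Uᴴ * U = 1)
  (p_pos : ∀ i, 0 < p i)
  (sum_p : ∑ i, p i = 1)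
  (unitaryV : ∀ j, (V j)ᴴ * V j = 1)
  (lam_nonneg : ∀ j, 0 ≤ lam j)
  (q_nonneg : ∀ j i, 0 ≤ q j i)
  -- This and the next field replace `∑ i, q j i = 1`, which fails for `λⱼ = 0`, where
  -- `canonicalState` is `0`.
  (sum_q_le : ∀ j, ∑ i, q j i ≤ 1)
  (lam_mul_sum_q : ∀ j, lam j * ∑ i, q j i = lam j)
  (sqrt_mul_mul_sqrt : ∀ j, conjDiag U (fun i => √(p i)) * a j * conjDiag U (fun i => √(p i)) =
    conjDiag (V j) fun i => lam j * q j i)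
  (povm : IsPOVM a)

lemma restrictionError_le {ι : Type*} [Fintype ι] {l : ℕ} {ρ : Matrix (Fin d) (Fin d) ℂ}
    {a : Fin m → Matrix (Fin d) (Fin d) ℂ} {ν : ℕ} {J : ι → Fin l → Fin m}
    {A : ι → Matrix (Fin l → Fin d) (Fin l → Fin d) ℂ} (hm : 0 < m) {c : ℝ} (hc : 0 ≤ c)
    (h : ∀ K : Finset (Fin l), K.card ≤ ν → ∀ j : K → Fin m,
      ‖restriction ρ J A K j - tensorProd (fun k : K => a (j k))‖ ≤ c) :
    restrictionError ρ a ν J A ≤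
      (Finset.univ.filter fun K : Finset (Fin l) => K.card ≤ ν).card * (m : ℝ) ^ ν * c := by
  have hm1 : (1 : ℝ) ≤ m := by exact_mod_cast hm
  rw [restrictionError, mul_assoc, ← nsmul_eq_mul, ← Finset.sum_const]
  refine Finset.sum_le_sum fun K hK => ?_
  have hK' := (Finset.mem_filter.mp hK).2
  calc _ ≤ ∑ _j : K → Fin m, c := Finset.sum_le_sum fun j _ => h K hK' j
    _ = (m : ℝ) ^ K.card * c := by simp
    _ ≤ (m : ℝ) ^ ν * c := by gcongr

/-- The product POVM has vanishing restriction error. -/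
lemma restrictionError_product {l : ℕ} {ρ : Matrix (Fin d) (Fin d) ℂ} (hρ1 : ρ.trace = 1)
    {a : Fin m → Matrix (Fin d) (Fin d) ℂ} (ha : IsPOVM a) (ν : ℕ) :
    ∃ (M : ℕ) (J : Fin M → Fin l → Fin m) (A : Fin M → Matrix (Fin l → Fin d) (Fin l → Fin d) ℂ),
      IsPOVM A ∧ restrictionError ρ a ν J A = 0 := by
  let e := (Fintype.equivFin (Fin l → Fin m)).symm
  refine ⟨_, fun μ => e μ, fun μ => tensorProd fun k => a (e μ k), ⟨fun μ => ?_, ?_⟩, ?_⟩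
  · exact tensorProd_posSemidef fun k => ha.1 _
  · rw [e.sum_comp (fun J => tensorProd fun k => a (J k))]
    have := sum_piFinset_tensorProd (fun _ : Fin l => Finset.univ) a
    rw [Fintype.piFinset_univ] at this
    rw [this, ha.2, tensorProd_one]
  · refine Finset.sum_eq_zero fun K _ => Finset.sum_eq_zero fun j _ => ?_
    rw [restriction, Finset.sum_filter,
      e.sum_comp (fun J => if ∀ k : K, J k = j k then tensorProd fun k => a (J k) else 0),
      ← Finset.sum_filter, partialTrace_product K hρ1 ha.2, sub_self, norm_zero]

variable {a : Fin m → Matrix (Fin d) (Fin d) ℂ} (D : EnsembleData a)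

lemma EnsembleData.sum_lam : ∑ j, D.lam j = 1 := by
  have h1 : ∀ j, (conjDiag D.U (fun i => √(D.p i)) * a j *
      conjDiag D.U (fun i => √(D.p i))).trace = ((D.lam j : ℝ) : ℂ) := by
    intro j
    rw [D.sqrt_mul_mul_sqrt, trace_conjDiag (D.unitaryV j), ← Finset.mul_sum, D.lam_mul_sum_q]
  have h2 : ((∑ j, D.lam j : ℝ) : ℂ) = 1 := by
    rw [Complex.ofReal_sum, Finset.sum_congr rfl fun j _ => (h1 j).symm, ← trace_sum,
      ← Finset.sum_mul, ← Finset.mul_sum, D.povm.2, Matrix.mul_one, conjDiag_mul D.unitary,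
      trace_conjDiag D.unitary, ← Complex.ofReal_one, ← D.sum_p]
    congr 1
    exact Finset.sum_congr rfl fun i _ => Real.mul_self_sqrt (D.p_pos i).le
  exact_mod_cast h2

/-- The `l`-fold product ensemble: the truncation bounds for a threshold `t` on the conditional
probabilities and a threshold `s` on the probabilities imply the existence of a POVM with `N`
outcomes and small restriction error. -/
lemma EnsembleData.exists_povm (hm : 0 < m) {q₀ : ℝ} (hq₀ : 0 < q₀) (hq₁ : q₀ ≤ 1)
    (hp : ∀ i, q₀ ≤ D.p i) {l : ℕ} (ν : ℕ) {s t η : ℝ} (hs : 0 < s) (ht : 0 < t)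
    (hηq : ∑ z : Fin l → Fin m × Fin d with t < ∏ k, D.q (z k).1 (z k).2,
      ∏ k, (D.lam (z k).1 * D.q (z k).1 (z k).2) ≤ η)
    (hηp : ∑ x : Fin l → Fin d with ∏ k, D.p (x k) < s, ∏ k, D.p (x k) ≤ η) :
    1 ≤ 2 * √η + η + √(s⁻¹) * √t ∧
    ∀ (N : ℕ), 0 < N → ∀ ζ e : ℝ, 0 < ζ → e ≤ 1 →
      √(s⁻¹) *
        √((Finset.univ.filter fun K : Finset (Fin l) => K.card ≤ ν).card * (m : ℝ) ^ ν * t / N)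
        + ζ + (2 * √η + η) ≤ e →
      ∃ (J : Fin N → Fin l → Fin m) (A : Fin N → Matrix (Fin l → Fin d) (Fin l → Fin d) ℂ),
        IsPOVM A ∧ restrictionError (conjDiag D.U D.p) a ν J A ≤
          (Finset.univ.filter fun K : Finset (Fin l) => K.card ≤ ν).card * (m : ℝ) ^ ν *
            ((q₀⁻¹) ^ ν * (3 * √e + e)) := by
  have hm1 : (1 : ℝ) ≤ m := by exact_mod_cast hm
  set w := conjDiag D.U fun i => √(D.p i) with hw
  have hww : w * w = conjDiag D.U D.p := by
    rw [hw, conjDiag_mul D.unitary]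
    congr 1; ext i
    exact Real.mul_self_sqrt (D.p_pos i).le
  set r := tensorProd fun _ : Fin l => w with hr
  set S : (Fin l → Fin m) → Matrix (Fin l → Fin d) (Fin l → Fin d) ℂ :=
    fun J => tensorProd fun k => a (J k) with hS
  set UL := tensorProd fun _ : Fin l => D.U with hUL
  have hULu : ULᴴ * UL = 1 := tensorProd_unitary fun _ => D.unitary
  set VL : (Fin l → Fin m) → Matrix (Fin l → Fin d) (Fin l → Fin d) ℂ :=
    fun J => tensorProd fun k => D.V (J k) with hVL
  have hVLu : ∀ J, (VL J)ᴴ * VL J = 1 := fun J => tensorProd_unitary fun _ => D.unitaryV _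
  set P : (Fin l → Fin m) → ℝ := fun J => ∏ k, D.lam (J k) with hPdef
  set qL : (Fin l → Fin m) → (Fin l → Fin d) → ℝ := fun J x => ∏ k, D.q (J k) (x k) with hqL
  -- `G J` drops the eigenvalues of the product state above `t`; `Q` below projects onto the
  -- eigenvalues of `ρ^{⊗l}` that are at least `s`.
  set G : (Fin l → Fin m) → Matrix (Fin l → Fin d) (Fin l → Fin d) ℂ :=
    fun J => conjDiag (VL J) fun x => if qL J x ≤ t then qL J x else 0 with hG
  set Q := conjDiag UL fun x => if ∏ k, D.p (x k) < s then 0 else 1 with hQdef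
  have hrr : r * r = conjDiag UL fun x => ∏ k, D.p (x k) := by
    rw [hr, tensorProd_mul, hww, tensorProd_conjDiag]
  have hrp : r.PosSemidef := tensorProd_posSemidef fun _ =>
    conjDiag_posSemidef _ fun i => Real.sqrt_nonneg _
  have hpL : ∀ x : Fin l → Fin d, 0 < ∏ k, D.p (x k) := fun x =>
    Finset.prod_pos fun k _ => D.p_pos _
  have hqL0 : ∀ J x, 0 ≤ qL J x := fun J x => Finset.prod_nonneg fun k _ => D.q_nonneg _ _
  have hsum_prod : ∀ {β : Type} [Fintype β] (f : Fin l → β → ℝ),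
      ∑ x : Fin l → β, ∏ k, f k (x k) = ∏ k, ∑ b, f k b := by
    intro β _ f
    rw [Finset.prod_univ_sum, Fintype.piFinset_univ]
  have hpsum : ∑ x : Fin l → Fin d, ∏ k, D.p (x k) = 1 := by
    rw [hsum_prod fun _ b => D.p b]; simp [D.sum_p]
  have hP0 : ∀ J, 0 ≤ P J := fun J => Finset.prod_nonneg fun k _ => D.lam_nonneg _
  have hP1 : ∑ J, P J = 1 := by
    rw [hPdef, hsum_prod fun _ b => D.lam b]; simp [D.sum_lam]
  have hSsum : ∑ J, S J = 1 := by
    have := sum_piFinset_tensorProd (fun _ : Fin l => Finset.univ) a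
    rw [Fintype.piFinset_univ] at this
    rw [hS, this, D.povm.2, tensorProd_one]
  have hTsum : ∑ J, r * S J * r = r * r := by
    rw [← Finset.sum_mul, ← Finset.mul_sum, hSsum, Matrix.mul_one]
  have hT : ∀ J, r * S J * r = conjDiag (VL J) fun x => P J * qL J x := by
    intro J
    rw [hr, hS]
    simp only
    rw [tensorProd_mul, tensorProd_mul]
    simp only [hw, D.sqrt_mul_mul_sqrt]
    rw [tensorProd_conjDiag]
    congr 1; ext x
    rw [Finset.prod_mul_distrib]
  have hTG : ∀ J, r * S J * r - (P J : ℂ) • G J =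
      conjDiag (VL J) fun x => if t < qL J x then P J * qL J x else 0 := by
    intro J
    rw [hT, hG]
    simp only
    rw [← conjDiag_smul, conjDiag_sub]
    congr 1; ext x
    simp only [Pi.sub_apply, Pi.smul_apply, smul_eq_mul]
    rcases le_or_gt (qL J x) t with h | h
    · simp [h, not_lt.mpr h]
    · simp [h, not_le.mpr h]
  have hGp : ∀ J, (G J).PosSemidef := fun J => conjDiag_posSemidef _ fun x => by
    split_ifs
    · exact hqL0 J x
    · exact le_rfl
  have hTGp : ∀ J, (r * S J * r - (P J : ℂ) • G J).PosSemidef := fun J => by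
    rw [hTG]
    refine conjDiag_posSemidef _ fun x => ?_
    split_ifs
    · exact mul_nonneg (hP0 J) (hqL0 J x)
    · exact le_rfl
  have hRd : (∑ J, r * S J * r).PosDef := by
    rw [hTsum, hrr]; exact conjDiag_posDef hULu hpL
  have hrr1 : (r * r).trace = 1 := by
    rw [hrr, trace_conjDiag hULu, hpsum, Complex.ofReal_one]
  have hR1 : (∑ J, r * S J * r).trace = 1 := by rw [hTsum, hrr1]
  have hQh : Q.IsHermitian := conjDiag_isHermitian _ _
  have hQQ : Q * Q = Q := by
    rw [hQdef, conjDiag_mul hULu]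
    congr 1; ext x
    simp only [Pi.mul_apply]
    split_ifs <;> simp
  have hQ1 : ‖Q‖ ≤ 1 := norm_conjDiag_le hULu zero_le_one fun x => by split_ifs <;> simp
  have hη1 : (∑ J, (r * S J * r - (P J : ℂ) • G J)).trace.re ≤ η := by
    refine le_trans (le_of_eq ?_) hηq
    rw [trace_sum, Complex.re_sum, Finset.sum_filter,
      ← (Equiv.arrowProdEquivProdArrow (Fin l) (fun _ => Fin m) (fun _ => Fin d)).symm.sum_comp,
      Fintype.sum_prod_type]
    refine Finset.sum_congr rfl fun J _ => ?_
    rw [hTG, trace_conjDiag (hVLu J), Complex.ofReal_re]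
    refine Finset.sum_congr rfl fun x _ => ?_
    simp only [Equiv.arrowProdEquivProdArrow, Equiv.coe_fn_symm_mk, Finset.prod_mul_distrib, hqL,
      hPdef]
  have hη2 : ((∑ J, r * S J * r) * (1 - Q)).trace.re ≤ η := by
    refine le_trans (le_of_eq ?_) hηp
    rw [hTsum, hrr, ← conjDiag_one hULu, hQdef, conjDiag_sub, conjDiag_mul hULu,
      trace_conjDiag hULu, Complex.ofReal_re, Finset.sum_filter]
    refine Finset.sum_congr rfl fun x _ => ?_
    simp only [Pi.mul_apply, Pi.sub_apply, Pi.one_apply]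
    split_ifs <;> simp
  have hGt : ∀ J, hsSq (G J) ≤ t := by
    intro J
    have h1 := trace_conjTranspose_mul_self (G J)
    rw [(hGp J).1.eq, hG] at h1
    simp only at h1
    rw [conjDiag_mul (hVLu J), trace_conjDiag (hVLu J)] at h1
    rw [← Complex.ofReal_injective h1]
    calc _ ≤ ∑ x, t * qL J x := Finset.sum_le_sum fun x _ => by
          simp only [Pi.mul_apply]
          split_ifs with h
          · exact mul_le_mul_of_nonneg_right h (hqL0 J x)
          · simpa using mul_nonneg ht.le (hqL0 J x)
      _ = t * ∏ k, ∑ i, D.q (J k) i := by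
          rw [← Finset.mul_sum, hqL]
          simp only
          rw [hsum_prod fun k b => D.q (J k) b]
      _ ≤ t * 1 := by
          gcongr
          exact Finset.prod_le_one (fun k _ => Finset.sum_nonneg fun i _ => D.q_nonneg _ _)
            fun k _ => D.sum_q_le _
      _ = t := mul_one t
  have hQτ : Q.trace.re ≤ s⁻¹ := by
    rw [hQdef, trace_conjDiag hULu, Complex.ofReal_re]
    calc _ ≤ ∑ x : Fin l → Fin d, s⁻¹ * ∏ k, D.p (x k) := Finset.sum_le_sum fun x _ => by
          split_ifs with h
          · exact mul_nonneg (inv_nonneg.mpr hs.le) (hpL x).le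
          · rw [← div_eq_inv_mul, le_div_iff₀ hs, one_mul]
            exact not_lt.mp h
      _ = s⁻¹ := by rw [← Finset.mul_sum, hpsum, mul_one]
  refine ⟨one_le_of_truncation hP0 hP1 hGp hTGp hR1 hQh hQQ hQ1 hη1 hη2 hGt hQτ, ?_⟩
  intro N hN ζ e hζ he1 he
  set C : ℝ := (Finset.univ.filter fun K : Finset (Fin l) => K.card ≤ ν).card * (m : ℝ) ^ ν with hC
  -- The events to be covered: a small set `K` with labels prescribed on it.
  let I := Σ K : {K : Finset (Fin l) // K.card ≤ ν}, (K.1 → Fin m)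
  let E : I → (Fin l → Fin m) → Prop := fun i J => ∀ k : i.1.1, J k = i.2 k
  have hI : (Fintype.card I : ℝ) ≤ C := by
    rw [Fintype.card_sigma]
    push_cast
    calc _ ≤ ∑ _K : {K : Finset (Fin l) // K.card ≤ ν}, (m : ℝ) ^ ν :=
          Finset.sum_le_sum fun K _ => by
            simp only [Fintype.card_fun, Fintype.card_fin, Fintype.card_coe]
            push_cast
            exact pow_le_pow_right₀ hm1 K.2
      _ = C := by
          rw [Finset.sum_const, nsmul_eq_mul, Finset.card_univ, Fintype.card_subtype]
  obtain ⟨J, B, hB, hBd, hBE⟩ := exists_covering hP0 hP1 hGp hTGp hRd hR1 hQh hQQ hQ1 hη1 hη2 hGt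
    hQτ E hN hζ
  have hBE' : ∀ i, TraceNormLE (∑ μ with E i (J μ), B μ - ∑ j with E i j, r * S j * r) e := by
    intro i
    refine (hBE i).mono (le_trans ?_ he)
    gcongr
  let i₀ : I := ⟨⟨∅, by simp⟩, fun k => absurd k.2 (Finset.notMem_empty _)⟩
  have hi₀ : ∀ j, E i₀ j := fun j k => absurd k.2 (Finset.notMem_empty _)
  obtain ⟨A, hA, hAE⟩ := exists_povm_of_covering hB hBd hrp hrr1 hSsum E hi₀ he1 hBE'
  have he0 : 0 ≤ e := (hBE' i₀).nonneg
  refine ⟨J, A, hA, restrictionError_le hm (by positivity) fun K hK j => ?_⟩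
  have h1 : (conjDiag D.U D.p).trace = 1 := by
    rw [trace_conjDiag D.unitary, D.sum_p, Complex.ofReal_one]
  rw [← partialTrace_product K h1 D.povm.2 j, restriction]
  have hsub : ∀ Y Z : Matrix (Fin l → Fin d) (Fin l → Fin d) ℂ,
      partialTrace K Y - partialTrace K Z = partialTrace K (Y - Z) := by
    intro Y Z
    ext x y
    simp [partialTrace, Finset.sum_sub_distrib]
  rw [hsub, ← Matrix.mul_sub]
  refine (norm_partialTrace_le K D.unitary hq₀ hp _ (hAE ⟨⟨K, hK⟩, j⟩)).trans ?_
  gcongr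
  exact (one_le_inv₀ hq₀).mpr hq₁

end Product

end QMeas

namespace QMeas

open Matrix Filter Topology

/-! ### Entropies, exponents and the choice of rates. -/

section Asymptotics

variable {d m : ℕ}

lemma prob_eq_trace {ρ b w : Matrix (Fin d) (Fin d) ℂ} (hb : b.PosSemidef) (hw : w.PosSemidef)
    (hww : w * w = ρ) : (w * b * w).trace = ((prob ρ b : ℝ) : ℂ) := by
  have hpos : (w * b * w).PosSemidef := by
    have := hb.mul_mul_conjTranspose_same w
    rwa [hw.1.eq] at this
  have h1 : (w * b * w).trace = (ρ * b).trace := by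
    rw [trace_mul_comm, ← Matrix.mul_assoc, hww]
  refine Complex.ext ?_ ?_
  · rw [h1, prob, Complex.ofReal_re]
  · rw [Complex.ofReal_im]
    exact ((Complex.le_def.mp hpos.trace_nonneg).2).symm

namespace EnsembleData

variable {a : Fin m → Matrix (Fin d) (Fin d) ℂ}

/-- The entropy of the state, in natural units. -/
noncomputable def stateEntropy (D : EnsembleData a) : ℝ := ∑ i, Real.negMulLog (D.p i)

/-- The mean entropy of the canonical ensemble, in natural units. -/
noncomputable def meanEntropy (D : EnsembleData a) : ℝ :=
  ∑ j, D.lam j * ∑ i, Real.negMulLog (D.q j i)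

/-- The spectral data of a full rank state and of its canonical ensemble. -/
lemma exists_of_posDef {ρ : Matrix (Fin d) (Fin d) ℂ} (hρ : ρ.PosDef) (hρ1 : ρ.trace = 1)
    (ha : IsPOVM a) : ∃ D : EnsembleData a, conjDiag D.U D.p = ρ ∧
      entropyDefect ρ a = (D.stateEntropy - D.meanEntropy) / Real.log 2 := by
  obtain ⟨U, p, hU, hUp, hcfc, hp⟩ := exists_conjDiag hρ.isHermitian
  have hp0 : ∀ i, 0 < p i := fun i => hp ▸ hρ.eigenvalues_pos i
  have hw : cfc Real.sqrt ρ = conjDiag U fun i => √(p i) := hcfc Real.sqrt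
  set w := conjDiag U fun i => √(p i) with hwdef
  have hwp : w.PosSemidef := conjDiag_posSemidef U fun i => Real.sqrt_nonneg _
  have hww : w * w = ρ := by
    rw [hwdef, conjDiag_mul hU]
    conv_rhs => rw [hUp]
    congr 1; ext i
    exact Real.mul_self_sqrt (hp0 i).le
  have hpos : ∀ j, (w * a j * w).PosSemidef := fun j => by
    have := (ha.1 j).mul_mul_conjTranspose_same w
    rwa [hwp.1.eq] at this
  have htr : ∀ j, (w * a j * w).trace = ((prob ρ (a j) : ℝ) : ℂ) := fun j =>
    prob_eq_trace (ha.1 j) hwp hww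
  have hlam : ∀ j, 0 ≤ prob ρ (a j) := fun j => by
    have := trace_re_nonneg (hpos j)
    rwa [htr, Complex.ofReal_re] at this
  have hcan : ∀ j, canonicalState ρ (a j) =
      (((prob ρ (a j))⁻¹ : ℝ) : ℂ) • (w * a j * w) := fun j => by rw [canonicalState, hw]
  have hcanp : ∀ j, (canonicalState ρ (a j)).PosSemidef := fun j => by
    rw [hcan]; exact posSemidef_ofReal_smul (inv_nonneg.mpr (hlam j)) (hpos j)
  choose V q hV hVq hcfcV hq using fun j => exists_conjDiag (hcanp j).1
  have hsq : ∀ j, ∑ i, q j i = (prob ρ (a j))⁻¹ * prob ρ (a j) := fun j => by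
    have h := trace_conjDiag (hV j) (q j)
    rw [← hVq j, hcan, trace_smul, htr, smul_eq_mul, ← Complex.ofReal_mul] at h
    exact (Complex.ofReal_injective h).symm
  have hscale : ∀ j, w * a j * w = conjDiag (V j) fun i => prob ρ (a j) * q j i := fun j => by
    have h1 : conjDiag (V j) (fun i => prob ρ (a j) * q j i) =
        (prob ρ (a j) : ℂ) • canonicalState ρ (a j) := by
      have := conjDiag_smul (V j) (prob ρ (a j)) (q j)
      rw [← hVq j] at this
      rw [← this]; rfl
    rw [h1, hcan, smul_smul, ← Complex.ofReal_mul]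
    -- A positive matrix of trace `0` vanishes, so the scaling relation survives the default value.
    rcases eq_or_ne (prob ρ (a j)) 0 with h0 | h0
    · have h2 := htr j
      rw [h0, Complex.ofReal_zero, (hpos j).trace_eq_zero_iff] at h2
      rw [h2, smul_zero]
    · rw [mul_inv_cancel₀ h0, Complex.ofReal_one, one_smul]
  have hps : ∑ i, p i = 1 := by
    have h := trace_conjDiag hU p
    rw [← hUp, hρ1] at h
    exact_mod_cast h.symm
  refine ⟨⟨U, p, V, fun j => prob ρ (a j), q, hU, hp0, hps, hV, hlam,
    fun j i => by rw [hq]; exact (hcanp j).eigenvalues_nonneg i, fun j => ?_, fun j => ?_,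
    hscale, ha⟩, hUp.symm, ?_⟩
  · rw [hsq]; exact inv_mul_le_one
  · rw [hsq]
    rcases eq_or_ne (prob ρ (a j)) 0 with h0 | h0
    · simp [h0]
    · rw [inv_mul_cancel₀ h0, mul_one]
  · have h1 : entropy ρ = (∑ i, Real.negMulLog (p i)) / Real.log 2 := by
      rw [entropy, hcfc, trace_conjDiag hU, Complex.ofReal_re]
    have h2 : ∀ j, entropy (canonicalState ρ (a j)) =
        (∑ i, Real.negMulLog (q j i)) / Real.log 2 := fun j => by
      rw [entropy, hcfcV, trace_conjDiag (hV j), Complex.ofReal_re]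
    simp only [entropyDefect, h1, h2, stateEntropy, meanEntropy, sub_div, Finset.sum_div,
      mul_div_assoc]

variable (D : EnsembleData a)

/-- The untypical parts of the product ensemble are exponentially small. -/
lemma exists_truncation_bounds {δ : ℝ} (hδ : 0 < δ) : ∃ r : ℝ, 0 < r ∧ r < 1 ∧ ∀ l : ℕ,
    ∑ z : Fin l → Fin m × Fin d with
        Real.exp (l * (-D.meanEntropy + δ)) < ∏ k, D.q (z k).1 (z k).2,
      ∏ k, (D.lam (z k).1 * D.q (z k).1 (z k).2) ≤ r ^ l ∧
    ∑ x : Fin l → Fin d with ∏ k, D.p (x k) < Real.exp (-(l * (D.stateEntropy + δ))),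
      ∏ k, D.p (x k) ≤ r ^ l := by
  have hmp : ∑ i, D.p i * -Real.log (D.p i) = D.stateEntropy := by
    simp only [stateEntropy, Real.negMulLog, mul_neg, neg_mul]
  have hmq : ∑ z : Fin m × Fin d, D.lam z.1 * D.q z.1 z.2 * Real.log (D.q z.1 z.2) =
      -D.meanEntropy := by
    rw [Fintype.sum_prod_type, meanEntropy, ← Finset.sum_neg_distrib]
    refine Finset.sum_congr rfl fun j _ => ?_
    rw [Finset.mul_sum, ← Finset.sum_neg_distrib]
    refine Finset.sum_congr rfl fun i _ => ?_
    rw [Real.negMulLog]; ring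
  have hq1 : ∑ z : Fin m × Fin d, D.lam z.1 * D.q z.1 z.2 = 1 := by
    rw [Fintype.sum_prod_type, ← D.sum_lam]
    refine Finset.sum_congr rfl fun j _ => ?_
    simp only
    rw [← Finset.mul_sum, D.lam_mul_sum_q]
  obtain ⟨r₁, h10, h11, h1⟩ := exists_large_deviation_bound (fun i => (D.p_pos i).le) D.sum_p
    (fun i => -Real.log (D.p i)) hδ
  obtain ⟨r₂, h20, h21, h2⟩ := exists_large_deviation_bound
    (fun z : Fin m × Fin d => mul_nonneg (D.lam_nonneg z.1) (D.q_nonneg z.1 z.2)) hq1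
    (fun z => Real.log (D.q z.1 z.2)) hδ
  -- The `1 / 2` keeps the base strictly positive, so that its logarithm can be used later.
  refine ⟨max (max r₁ r₂) (1 / 2), lt_max_of_lt_right (by norm_num),
    max_lt (max_lt h11 h21) (by norm_num), fun l => ⟨?_, ?_⟩⟩
  · refine le_trans ?_ ((h2 l).trans (pow_le_pow_left₀ h20
      ((le_max_right _ _).trans (le_max_left _ _)) l))
    refine Finset.sum_le_sum_of_subset_of_nonneg (fun z hz => ?_) fun z _ _ =>
      Finset.prod_nonneg fun k _ => mul_nonneg (D.lam_nonneg _) (D.q_nonneg _ _)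
    simp only [Finset.mem_filter, Finset.mem_univ, true_and] at hz ⊢
    have hpos := (Real.exp_pos _).trans hz
    rw [hmq, ← Real.log_prod fun k _ => Finset.prod_ne_zero_iff.mp hpos.ne' k (Finset.mem_univ k)]
    exact (Real.le_log_iff_exp_le hpos).mpr hz.le
  · refine le_trans ?_ ((h1 l).trans (pow_le_pow_left₀ h10
      ((le_max_left _ _).trans (le_max_left _ _)) l))
    refine Finset.sum_le_sum_of_subset_of_nonneg (fun x hx => ?_) fun x _ _ =>
      Finset.prod_nonneg fun k _ => (D.p_pos _).le
    simp only [Finset.mem_filter, Finset.mem_univ, true_and] at hx ⊢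
    rw [hmp, Finset.sum_neg_distrib, ← Real.log_prod fun k _ => (D.p_pos _).ne']
    have := (Real.log_le_iff_le_exp (Finset.prod_pos fun k _ => D.p_pos (x k))).mpr hx.le
    linarith

lemma exists_lower_bound (hd : 0 < d) : ∃ q₀ : ℝ, 0 < q₀ ∧ q₀ ≤ 1 ∧ ∀ i, q₀ ≤ D.p i := by
  have : Nonempty (Fin d) := ⟨⟨0, hd⟩⟩
  obtain ⟨i, hi⟩ := Finite.exists_min D.p
  refine ⟨D.p i, D.p_pos i, ?_, hi⟩
  rw [← D.sum_p]
  exact Finset.single_le_sum (fun i _ => (D.p_pos i).le) (Finset.mem_univ i)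

/-- The entropy defect is nonnegative. -/
lemma meanEntropy_le_stateEntropy (hd : 0 < d) (hm : 0 < m) :
    D.meanEntropy ≤ D.stateEntropy := by
  -- Otherwise the typical subspace would be too small for the flat truncated states: their trace
  -- there would be at most `exp(-δ l)`, yet together they carry almost the whole trace `1`. With
  -- `δ` a quarter of the gap, the exponent `½(-4δ + 2δ)` equals `-δ`.
  by_contra! hlt
  obtain ⟨q₀, hq₀, hq₁, hp⟩ := D.exists_lower_bound hd
  set δ := (D.meanEntropy - D.stateEntropy) / 4 with hδ
  obtain ⟨r, hr0, hr1, hr⟩ := D.exists_truncation_bounds (δ := δ) (by linarith)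
  have key : ∀ l : ℕ, 1 ≤ 2 * √(r ^ l) + r ^ l + Real.exp (-δ) ^ l := by
    intro l
    have h := (D.exists_povm hm hq₀ hq₁ hp 0 (Real.exp_pos _) (Real.exp_pos _)
      (hr l).1 (hr l).2).1
    rw [← Real.sqrt_mul (by positivity), ← Real.exp_neg, ← Real.exp_add] at h
    have e : √(Real.exp (-(-(l * (D.stateEntropy + δ))) + l * (-D.meanEntropy + δ))) =
        Real.exp (-δ) ^ l := by
      rw [← Real.exp_nat_mul, ← Real.exp_half]
      congr 1
      rw [hδ]; ring
    rwa [e] at h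
  have hlim1 : Tendsto (fun l : ℕ => r ^ l) atTop (𝓝 0) :=
    tendsto_pow_atTop_nhds_zero_of_lt_one hr0.le hr1
  have hlim2 : Tendsto (fun l : ℕ => Real.exp (-δ) ^ l) atTop (𝓝 0) :=
    tendsto_pow_atTop_nhds_zero_of_lt_one (Real.exp_pos _).le
      (Real.exp_lt_one_iff.mpr (by linarith))
  have hlim : Tendsto (fun l : ℕ => 2 * √(r ^ l) + r ^ l + Real.exp (-δ) ^ l) atTop (𝓝 0) := by
    have := ((hlim1.sqrt.const_mul 2).add hlim1).add hlim2
    simpa using this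
  have := ge_of_tendsto' hlim key
  linarith

/-- At any rate above the entropy defect there is eventually a POVM with small restriction
error. -/
lemma eventually_exists_povm (hd : 0 < d) (hm : 0 < m) {ν : ℕ → ℕ}
    (hν : Asymptotics.IsLittleO atTop (fun l : ℕ => (ν l : ℝ)) (fun l : ℕ => (l : ℝ)))
    {ε : ℝ} (hε : 0 < ε) {δ : ℝ} (hδ : 0 < δ) :
    ∀ᶠ l : ℕ in atTop, ∃ (M : ℕ) (J : Fin M → Fin l → Fin m)
      (A : Fin M → Matrix (Fin l → Fin d) (Fin l → Fin d) ℂ), IsPOVM A ∧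
      (M : ℝ) ≤ Real.exp (l * (D.stateEntropy - D.meanEntropy + 5 * δ)) ∧
      restrictionError (conjDiag D.U D.p) a (ν l) J A ≤ ε := by
  obtain ⟨q₀, hq₀, hq₁, hp⟩ := D.exists_lower_bound hd
  obtain ⟨r, hr0, hr1, hr⟩ := D.exists_truncation_bounds hδ
  have hD := D.meanEntropy_le_stateEntropy hd hm
  set h := D.stateEntropy
  set hc := D.meanEntropy
  -- With this `c` both `r ^ l` and `exp(-δ l)` are at most `y ^ 2`, where `y = exp(-c l)`.
  set c := min (δ / 2) (-Real.log r / 2) with hcdef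
  have hc0 : 0 < c := lt_min (by linarith) (by linarith [Real.log_neg hr0 hr1])
  have hlim : ∀ b : ℝ, 0 < b → Tendsto (fun l : ℕ => Real.exp (-(b * l))) atTop (𝓝 0) := by
    intro b hb
    exact Real.tendsto_exp_neg_atTop_nhds_zero.comp
      (tendsto_natCast_atTop_atTop.const_mul_atTop hb)
  have ev1 := (hlim c hc0).eventually (ge_mem_nhds (show (0 : ℝ) < 1 / 5 by norm_num))
  have ev2 := (hlim (c / 4) (by linarith)).eventually (ge_mem_nhds (show 0 < ε / 12 by positivity))
  have ev3 := (hlim δ hδ).eventually (ge_mem_nhds (show (0 : ℝ) < 1 / 2 by norm_num))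
  filter_upwards [ev1, ev2, ev3, eventually_card_small_subsets_le hν (m : ℝ) hδ,
    eventually_card_small_subsets_le hν (m * q₀⁻¹) (show 0 < c / 4 by linarith)]
    with l hl1 hl2 hl3 hl4 hl5
  set C : ℝ := ((Finset.univ.filter fun K : Finset (Fin l) => K.card ≤ ν l).card : ℝ)
  have hL : (0 : ℝ) ≤ l := Nat.cast_nonneg l
  -- Of the `4δ`, two pay for the typicality thresholds, one for the number of events, and one
  -- leaves a sampling error that decays. The fifth `δ` in the rate absorbs the rounding `N ≤ 2x`,
  -- which needs `x ≥ 1` and hence a nonnegative defect.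
  set x := Real.exp (l * (h - hc + 4 * δ)) with hx
  have hx1 : 1 ≤ x := Real.one_le_exp (mul_nonneg hL (by linarith))
  set N := ⌈x⌉₊ with hN
  have hN0 : 0 < N := Nat.ceil_pos.mpr (by linarith)
  have hNx : x ≤ N := Nat.le_ceil x
  set y := Real.exp (-(c * l)) with hy
  have hy0 : 0 < y := Real.exp_pos _
  have hη : r ^ l ≤ y ^ 2 := by
    have : r ≤ Real.exp (-(2 * c)) := by
      rw [← Real.log_le_iff_le_exp hr0]
      have := min_le_right (δ / 2) (-Real.log r / 2)
      rw [← hcdef] at this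
      linarith
    calc r ^ l ≤ Real.exp (-(2 * c)) ^ l := pow_le_pow_left₀ hr0.le this l
      _ = y ^ 2 := by
        rw [hy, ← Real.exp_nat_mul, ← Real.exp_nat_mul]; congr 1; push_cast; ring
  have hsη : √(r ^ l) ≤ y := by
    rw [← Real.sqrt_sq hy0.le]; exact Real.sqrt_le_sqrt hη
  have hy1 : y ≤ 1 := by linarith
  have hηy : r ^ l ≤ y := hη.trans (by nlinarith)
  have hcδ : c ≤ δ / 2 := min_le_left _ _
  have hζ : Real.exp (-(δ * l)) ≤ y := Real.exp_le_exp.mpr (by nlinarith)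
  have hmain : √((Real.exp (-(l * (h + δ))))⁻¹) *
      √(C * (m : ℝ) ^ ν l * Real.exp (l * (-hc + δ)) / N) ≤ y := by
    rw [← Real.sqrt_mul (by positivity), ← Real.exp_neg]
    have : Real.exp (-(-(l * (h + δ)))) * (C * (m : ℝ) ^ ν l * Real.exp (l * (-hc + δ)) / N) ≤
        y ^ 2 := by
      calc _ ≤ Real.exp (-(-(l * (h + δ)))) *
            (Real.exp (δ * l) * Real.exp (l * (-hc + δ)) / x) := by gcongr
        _ = Real.exp (-(δ * l)) := by
            rw [hx, ← Real.exp_add, ← Real.exp_sub, ← Real.exp_add]; congr 1; ring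
        _ ≤ y ^ 2 := by
            rw [hy, ← Real.exp_nat_mul]
            exact Real.exp_le_exp.mpr (by push_cast; nlinarith)
    rw [← Real.sqrt_sq hy0.le]
    exact Real.sqrt_le_sqrt this
  -- The error budget `5y` is one `y` for sampling, one for `ζ`, and three for `2√η + η`.
  obtain ⟨J, A, hA, hAe⟩ := (D.exists_povm hm hq₀ hq₁ hp (ν l) (Real.exp_pos _) (Real.exp_pos _)
      (hr l).1 (hr l).2).2 N hN0 (Real.exp (-(δ * l))) (5 * y) (Real.exp_pos _) (by linarith)
      (by linarith)
  refine ⟨N, J, A, hA, ?_, hAe.trans ?_⟩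
  · have h1 : (N : ℝ) ≤ 2 * x := by
      have := (Nat.ceil_lt_add_one (by linarith : 0 ≤ x)).le
      linarith
    have h2 : 2 ≤ Real.exp (δ * l) := by
      rw [Real.exp_neg] at hl3
      have := (inv_le_comm₀ (Real.exp_pos _) (by norm_num)).mp hl3
      simpa using this
    calc (N : ℝ) ≤ 2 * x := h1
      _ ≤ Real.exp (δ * l) * x := by gcongr
      _ = _ := by rw [hx, ← Real.exp_add]; congr 1; ring
  -- As `y = z⁴`, the error `3√(5y) + 5y` is at most `12 z²`, and the subexponential factor is at
  -- most `1 / z`.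
  · set z := Real.exp (-(c / 4 * l)) with hz
    have hz0 : 0 < z := Real.exp_pos _
    have hyz : y = z ^ 4 := by
      rw [hy, hz, ← Real.exp_nat_mul]; congr 1; push_cast; ring
    have hz1 : z ≤ 1 := Real.exp_le_one_iff.mpr (neg_nonpos.mpr (by positivity))
    have h4 : z ^ 4 ≤ z ^ 2 := pow_le_pow_of_le_one hz0.le hz1 (by norm_num)
    have h5 : √(5 * y) ≤ 7 / 3 * z ^ 2 := by
      rw [Real.sqrt_le_left (by positivity), hyz]
      nlinarith [pow_pos hz0 4]
    have h6 : 3 * √(5 * y) + 5 * y ≤ 12 * z ^ 2 := by rw [hyz] at h5 ⊢; linarith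
    calc C * (m : ℝ) ^ ν l * (q₀⁻¹ ^ ν l * (3 * √(5 * y) + 5 * y))
        = C * (m * q₀⁻¹) ^ ν l * (3 * √(5 * y) + 5 * y) := by rw [mul_pow]; ring
      _ ≤ Real.exp (c / 4 * l) * (12 * z ^ 2) := by gcongr
      _ = 12 * z := by
          rw [hz, Real.exp_neg]; field_simp
      _ ≤ ε := by linarith

end EnsembleData

end Asymptotics

end QMeas

/-! ### From every rate above the defect to a single `o(l)` correction. -/

theorem theorem4 {d m : ℕ}
    (ρ : Matrix (Fin d) (Fin d) ℂ) (hρ : ρ.PosDef) (hρ1 : ρ.trace = 1)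
    (a : Fin m → Matrix (Fin d) (Fin d) ℂ) (ha : QMeas.IsPOVM a)
    (ν : ℕ → ℕ)
    (hν : Asymptotics.IsLittleO Filter.atTop (fun l : ℕ => (ν l : ℝ)) (fun l : ℕ => (l : ℝ)))
    (ε : ℝ) (hε : 0 < ε) :
    ∃ f : ℕ → ℝ, Asymptotics.IsLittleO Filter.atTop f (fun l : ℕ => (l : ℝ)) ∧
      ∀ l : ℕ, ∃ (M : ℕ) (J : Fin M → Fin l → Fin m)
        (A : Fin M → Matrix (Fin l → Fin d) (Fin l → Fin d) ℂ),
        QMeas.IsPOVM A ∧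
        (M : ℝ) ≤ (2 : ℝ) ^ ((l : ℝ) * QMeas.entropyDefect ρ a + f l) ∧
        QMeas.restrictionError ρ a (ν l) J A ≤ ε := by
  classical
  have hd : 0 < d := by
    rcases Nat.eq_zero_or_pos d with rfl | h
    · simp [Matrix.trace] at hρ1
    · exact h
  have hm : 0 < m := by
    rcases Nat.eq_zero_or_pos m with rfl | h
    · have h1 := ha.2
      simp only [Finset.univ_eq_empty, Finset.sum_empty] at h1
      have := congrFun (congrFun h1 ⟨0, hd⟩) ⟨0, hd⟩
      simp at this
    · exact h
  obtain ⟨D, hDρ, hDdef⟩ := QMeas.EnsembleData.exists_of_posDef hρ hρ1 ha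
  have hDle := D.meanEntropy_le_stateEntropy hd hm
  have hlog2 : 0 < Real.log 2 := Real.log_pos one_lt_two
  set Δ := QMeas.entropyDefect ρ a with hΔ
  have hΔ0 : 0 ≤ Δ := by rw [hDdef]; exact div_nonneg (by linarith) hlog2.le
  let good : ℕ → ℕ → Prop := fun l M => ∃ (J : Fin M → Fin l → Fin m)
    (A : Fin M → Matrix (Fin l → Fin d) (Fin l → Fin d) ℂ),
      QMeas.IsPOVM A ∧ QMeas.restrictionError ρ a (ν l) J A ≤ ε
  have hgood : ∀ l, ∃ M, good l M := fun l => by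
    obtain ⟨M, J, A, hA, h0⟩ := QMeas.restrictionError_product (l := l) hρ1 ha (ν l)
    exact ⟨M, J, A, hA, h0.le.trans hε.le⟩
  -- The least admissible number of outcomes defines `f`, so one function serves all rates; the
  -- product POVM shows that the minimum exists for every `l`.
  let f : ℕ → ℝ := fun l => max 0 (Real.logb 2 (Nat.find (hgood l)) - l * Δ)
  refine ⟨f, ?_, fun l => ?_⟩
  · rw [Asymptotics.isLittleO_iff]
    intro c hc
    -- This cancels the `5δ` of the rate and the change from base `e` to base `2`.
    have hδ : 0 < c * Real.log 2 / 5 := by positivity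
    filter_upwards [D.eventually_exists_povm hd hm hν hε hδ] with l hl
    obtain ⟨M, J, A, hA, hM, hAe⟩ := hl
    rw [hDρ] at hAe
    have hfind : Nat.find (hgood l) ≤ M := Nat.find_min' (hgood l) ⟨J, A, hA, hAe⟩
    have hL : (0 : ℝ) ≤ l := Nat.cast_nonneg l
    rw [Real.norm_of_nonneg (le_max_left _ _), Real.norm_of_nonneg hL]
    refine max_le (by positivity) ?_
    rw [sub_le_iff_le_add]
    rcases Nat.eq_zero_or_pos (Nat.find (hgood l)) with h0 | h0
    · rw [h0]
      simp only [Nat.cast_zero, Real.logb_zero]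
      positivity
    · have h1 : ((Nat.find (hgood l) : ℕ) : ℝ) ≤
          Real.exp (l * (D.stateEntropy - D.meanEntropy + 5 * (c * Real.log 2 / 5))) :=
        le_trans (by exact_mod_cast hfind) hM
      have h2 := (Real.log_le_iff_le_exp (by exact_mod_cast h0)).mpr h1
      rw [Real.logb, div_le_iff₀ hlog2, hDdef]
      refine h2.trans (le_of_eq ?_)
      field_simp
      ring
  · obtain ⟨J, A, hA, hAe⟩ := Nat.find_spec (hgood l)
    refine ⟨Nat.find (hgood l), J, A, hA, ?_, hAe⟩
    rcases Nat.eq_zero_or_pos (Nat.find (hgood l)) with h0 | h0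
    · rw [h0]
      simp only [Nat.cast_zero]
      positivity
    · rw [← Real.logb_le_iff_le_rpow one_lt_two (by exact_mod_cast h0)]
      have := le_max_right 0 (Real.logb 2 (Nat.find (hgood l)) - l * Δ)
      change _ ≤ _ + f l
      simp only [f]
      linarith
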